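/- Let $k$ be a field. A \emph{monomial operad} $\mathcal P=(\mathcal V,\mathcal R)$ is the quotient of the free operad on a finite set $\mathcal V$ of generators (each with an arity) by the ideal generated by a finite set $\mathcal R=\{w_1,\dots,w_r\}$ of tree monomials, each with at least one internal vertex; it has as a basis the tree monomials in which no $w_i$ occurs as a subtree. Here a tree monomial is a planar rooted tree whose internal vertices are labelled by generators of the right arity; in the nonsymmetric case the leaves are unlabelled, in the symmetric case (the free symmetric operad on the free symmetric collection generated by $\mathcal V$) the leaves carry labels and occurrences of the $w_i$ do not depend on the labels. The bar construction of $\mathcal P$ has as basis the planar trees whose vertices are decorated by nontrivial nonzero tree monomials of $\mathcal P$ with as many leaves as the vertex has inputs; its differential is the sum of all contractions of an internal edge (composing the two decorations, the result being $0$ if it is zero in $\mathcal P$), with Koszul signs for vertices of degree one. For a tree monomial $w$ with labels in $\mathcal V$, let $\mathcal B_w$ be the subcomplex spanned by the decorated trees whose total composition is $w$, where a decorated tree has degree $j$ if it is obtained by performing $j$ compositions, i.e. if it has $N-j$ vertices, $N$ being the number of internal vertices of $w$. For a finite set $X=\{x_1,\dots,x_n\}$ and a set $\mathcal S$ of subsets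 of $X$ let $A$ be the Grassmann (exterior) algebra over $k$ on the variables $x_1,\dots,x_n$, let $M$ be the two-sided ideal generated by the monomials $\prod_{x\in S}x$, $S\in\mathcal S$, and let $\mathcal B^{Gr}(X,\mathcal S)$ be the complex $\bar A=A/M$ with the grading induced from $A$ and the differential $d(u)=u(x_1+\dots+x_n)$. (1) Let $\mathcal P$ be a monomial operad and $w$ a tree monomial in its generators. Let $X$ be the set of internal edges of $w$ (equivalently, of its internal vertices other than the root vertex), and let $\mathcal S$ consist of the sets of internal edges of all occurrences of the relations $w_1,\dots,w_r$ as subtrees of $w$. Then there is a quasi-isomorphism of complexes $\mathcal B_w\to\mathcal B^{Gr}(X,\mathcal S)$; in particular $H_\bullet(\mathcal B_w)\cong H_\bullet(\mathcal B^{Gr}(X,\mathcal S))$. (2) Conversely, for every $n\ge 0$ and every set $\mathcal S$ of subsets of $\{x_1,\dots,x_n\}$ there are a (nonsymmetric) monomial operad $\mathcal P$ and a tree monomial $w$ in its generators such that $H_j(\mathcal B_w)\cong H_j(\mathcal B^{Gr}(\{x_1,\dots,x_n\},\mathcal S))$ for all $j$. -/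

import Mathlib

open CategoryTheory

/-- Planar rooted trees whose internal vertices are labelled by generators `v : V` of arity `ar v`
and whose leaves are labelled by elements of `L`: the tree monomials of the free operad on `V`.
With `L = Unit` these are the tree monomials of the free nonsymmetric operad; with leaves labelled
bijectively by `L = Fin m` they are those of the free symmetric operad on the free symmetric
collection generated by `V`. The tree `leaf l` is the trivial tree (the operadic unit). -/
inductive PTree (V : Type) (ar : V → ℕ) (L : Type) : Type
  | leaf (l : L) : PTree V ar L
  | node (v : V) (c : Fin (ar v) → PTree V ar L) : PTree V ar L

namespace PTree

variable {V : Type} {ar : V → ℕ} {L M : Type}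

/-- The number of leaves (inputs) of a tree. -/
def numLeaves : PTree V ar L → ℕ
  | leaf _ => 1
  | node _ c => ∑ i, numLeaves (c i)

/-- The number of internal vertices of a tree. -/
def size : PTree V ar L → ℕ
  | leaf _ => 0
  | node _ c => 1 + ∑ i, size (c i)

/-- Operadic composition of tree monomials: the `p`-th leaf of `t` (leaves are numbered from left to
right) is replaced by the tree `f p`. -/
def graft : (t : PTree V ar Unit) → (Fin t.numLeaves → PTree V ar L) → PTree V ar L
  | leaf _, f => f (0 : Fin 1)
  | node v c, f => node v fun i => graft (c i) fun p => f (finSigmaFinEquiv ⟨i, p⟩)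

/-- The tree with its leaf labels forgotten. -/
def shape : PTree V ar L → PTree V ar Unit
  | leaf _ => leaf ()
  | node v c => node v fun i => shape (c i)

/-- The label of the `p`-th leaf, counted from left to right. -/
def label : (t : PTree V ar L) → Fin t.shape.numLeaves → L
  | leaf l, _ => l
  | node _ c, p => label (c (finSigmaFinEquiv.symm p).1) (finSigmaFinEquiv.symm p).2

/-- The full subtree of `t` above the place with address `a`: an address is the list of the numbers of
the inputs which are followed on the way up from the root. -/
def subtreeAt : PTree V ar L → List ℕ → Option (PTree V ar L)
  | t, [] => some t
  | leaf _, _ :: _ => none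
  | node v c, i :: a => if h : i < ar v then subtreeAt (c ⟨i, h⟩) a else none

/-- The set of addresses of the internal vertices. -/
def vertices : PTree V ar L → Finset (List ℕ)
  | leaf _ => ∅
  | node _ c => insert [] (Finset.univ.biUnion fun i => (vertices (c i)).image (List.cons i.val))

/-- The internal edges of a tree (those joining two internal vertices). An internal edge is named by the
address of its upper end, which is an internal vertex other than the root vertex. -/
def edges (t : PTree V ar L) : Finset (List ℕ) := t.vertices.erase []

/-- The tree has no internal vertex. -/
def IsTrivial : PTree V ar L → Prop
  | leaf _ => True
  | node _ _ => False

end PTree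

/-- The nontrivial tree monomials: the standard basis of the augmentation ideal of the free operad. -/
abbrev NTMonomial (V : Type) (ar : V → ℕ) : Type := {t : PTree V ar Unit // ¬ t.IsTrivial}

/-- Decorated trees: planar trees whose vertices are decorated by nontrivial tree monomials, a vertex
with decoration `m` having as many inputs as `m` has leaves. They are the standard basis of the bar
construction of the free operad, i.e. of the cofree cooperad on its suspended augmentation ideal. -/
abbrev DTree (V : Type) (ar : V → ℕ) (L : Type) : Type :=
  PTree (NTMonomial V ar) (fun m => m.1.numLeaves) L

namespace DTree
open PTree
variable {V : Type} {ar : V → ℕ} {L : Type}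

/-- The tree monomial obtained by performing all the compositions in a decorated tree. -/
def flatten : DTree V ar L → PTree V ar L
  | .leaf l => .leaf l
  | .node m c => graft m.1 fun p => flatten (c p)

/-- A tree `N` with at least one vertex and with leaves labelled by decorated trees, seen as a single
vertex decorated by (the shape of) `N`, whose inputs are the labels of `N`. -/
def ofLabelled : PTree V ar (DTree V ar L) → DTree V ar L
  | .leaf T => T
  | .node v c => .node ⟨shape (.node v c), fun h => h⟩ (label (.node v c))

/-- Contraction of the edge joining the root vertex, decorated by `m` with inputs `c`, to its `p`-th
input, which is a vertex decorated by `m'` with inputs `c'`. The new root vertex is decorated by the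
partial composition `m ∘_p m'`; its inputs are those of `m` with the `p`-th one replaced by `c'`. -/
def contractAt (m : NTMonomial V ar) (c : Fin m.1.numLeaves → DTree V ar L) (p : Fin m.1.numLeaves)
    (m' : NTMonomial V ar) (c' : Fin m'.1.numLeaves → DTree V ar L) : DTree V ar L :=
  ofLabelled (graft m.1 fun q => if q = p then graft m'.1 fun r => .leaf (c' r) else .leaf (c q))

/-- Contraction of the edge from the root vertex to its `p`-th input, if that input is a vertex
(otherwise there is no such edge, and the term is zero). -/
noncomputable def contractInput (k : Type*) [Field k] (m : NTMonomial V ar) (c : Fin m.1.numLeaves → DTree V ar L)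
    (p : Fin m.1.numLeaves) : DTree V ar L → (DTree V ar L →₀ k)
  | .leaf _ => 0
  | .node m' c' => Finsupp.single (contractAt m c p m' c') 1

/-- The differential of the bar construction of the free operad: the signed sum of the contractions of
all the edges of a decorated tree. All vertices have degree one (suspension) and are ordered from
the root up and from left to right, and the signs come from the Koszul rule: to compose the root
vertex with its `p`-th input, the latter is moved past the vertices of the inputs `q < p`, and to
act on the `p`-th input the differential is moved past these and past the root vertex. -/
noncomputable def barDiff (k : Type*) [Field k] : DTree V ar L → (DTree V ar L →₀ k)
  | .leaf _ => 0
  | .node m c => ∑ p, (-1 : k) ^ (∑ q ∈ Finset.Iio p, (c q).size) •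
      (contractInput k m c p (c p) -
        (barDiff k (c p)).mapDomain fun T => .node m (Function.update c p T))

end DTree


namespace PTree
variable {V : Type} {ar : V → ℕ} {L M : Type}
/-- Substitution into the leaves according to their labels (used in proofs only). -/
def bind : PTree V ar M → (M → PTree V ar L) → PTree V ar L
  | leaf x, f => f x
  | node v c, f => node v fun i => bind (c i) f

theorem graft_shape (N : PTree V ar M) (f : M → PTree V ar L) :
    graft N.shape (fun p => f (N.label p)) = N.bind f := by
  induction N with
  | leaf x => rfl
  | node v c ih =>
    simp only [shape, graft, bind, label]
    congr 1; funext i; rw [← ih i]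
    congr 1; funext p
    exact congrArg (fun z : (i : Fin (ar v)) × Fin (c i).shape.numLeaves => f ((c z.1).label z.2))
      (Equiv.symm_apply_apply finSigmaFinEquiv ⟨i, p⟩)

theorem bind_graft (m : PTree V ar Unit) (g : Fin m.numLeaves → PTree V ar M)
    (f : M → PTree V ar L) : (graft m g).bind f = graft m fun p => (g p).bind f := by
  induction m with
  | leaf x => rfl
  | node v c ih => simp only [graft, bind, ih]

theorem bind_leaf (N : PTree V ar M) : N.bind leaf = N := by
  induction N with
  | leaf x => rfl
  | node v c ih => simp only [bind, ih]

theorem shape_graft (m : PTree V ar Unit) (g : Fin m.numLeaves → PTree V ar L) :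
    (graft m g).shape = graft m fun p => (g p).shape := by
  induction m with
  | leaf x => rfl
  | node v c ih => simp only [graft, shape, ih]

theorem graft_graft (m : PTree V ar Unit) (g : Fin m.numLeaves → PTree V ar Unit)
    (f : Fin (graft m g).numLeaves → PTree V ar L) :
    ∃ h, graft (graft m g) f = graft m h := by
  induction m with
  | leaf x => exact ⟨fun _ => graft (g (0 : Fin 1)) f, rfl⟩
  | node v c ih =>
    choose h hh using fun i => ih i (fun p => g (finSigmaFinEquiv ⟨i, p⟩))
      (fun p => f (finSigmaFinEquiv ⟨i, p⟩))
    refine ⟨fun p => h (finSigmaFinEquiv.symm p).1 (finSigmaFinEquiv.symm p).2, ?_⟩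
    simp only [graft]
    congr 1; funext i; rw [hh i]
    congr 1; funext p
    exact (congrArg (fun z : (i : Fin (ar v)) × Fin (c i).numLeaves => h z.1 z.2)
      (Equiv.symm_apply_apply finSigmaFinEquiv ⟨i, p⟩)).symm

theorem subtreeAt_graft (m : PTree V ar Unit) (g : Fin m.numLeaves → PTree V ar L)
    (a : List ℕ) (s : PTree V ar Unit) (h : m.subtreeAt a = some s) :
    ∃ g', (graft m g).subtreeAt a = some (graft s g') := by
  induction m generalizing a with
  | leaf x =>
    cases a with
    | nil => simp only [subtreeAt, Option.some.injEq] at h; subst h; exact ⟨g, by simp [subtreeAt]⟩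
    | cons i a => simp [subtreeAt] at h
  | node v c ih =>
    cases a with
    | nil => simp only [subtreeAt, Option.some.injEq] at h; subst h; exact ⟨g, by simp [subtreeAt]⟩
    | cons i a =>
      simp only [subtreeAt] at h
      split at h
      · rename_i hi
        obtain ⟨g', hg⟩ := ih ⟨i, hi⟩ (fun p => g (finSigmaFinEquiv ⟨_, p⟩)) a h
        exact ⟨g', by simp only [graft, subtreeAt, hi, dite_true, hg]⟩
      · simp at h

theorem exists_subtreeAt_input (m : PTree V ar Unit) (g : Fin m.numLeaves → PTree V ar L)
    (p : Fin m.numLeaves) :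
    ∃ a, ∀ b, (graft m g).subtreeAt (a ++ b) = (g p).subtreeAt b := by
  induction m with
  | leaf x => exact ⟨[], fun b => by
      have : p = (0 : Fin 1) := Subsingleton.elim (α := Fin 1) _ _
      subst this; rfl⟩
  | node v c ih =>
    obtain ⟨⟨i, q⟩, rfl⟩ := finSigmaFinEquiv.surjective p
    obtain ⟨a, ha⟩ := ih i (fun p => g (finSigmaFinEquiv ⟨i, p⟩)) q
    refine ⟨i.val :: a, fun b => ?_⟩
    simp [graft, subtreeAt, ha]

theorem exists_label_graft (m : PTree V ar Unit) (g : Fin m.numLeaves → PTree V ar L)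
    (p : Fin m.numLeaves) (q : Fin (g p).shape.numLeaves) :
    ∃ r, (graft m g).label r = (g p).label q := by
  induction m with
  | leaf x =>
      have : p = (0 : Fin 1) := Subsingleton.elim (α := Fin 1) _ _
      subst this; exact ⟨q, rfl⟩
  | node v c ih =>
    obtain ⟨⟨i, p⟩, rfl⟩ := finSigmaFinEquiv.surjective p
    obtain ⟨r, hr⟩ := ih i (fun p => g (finSigmaFinEquiv ⟨i, p⟩)) p q
    refine ⟨finSigmaFinEquiv ⟨i, r⟩, ?_⟩
    simp only [graft, label]
    have key : ∀ z : (i : Fin (ar v)) × Fin ((graft (c i) fun p => g (finSigmaFinEquiv ⟨i, p⟩)).shape.numLeaves), z = ⟨i, r⟩ →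
      (graft (c z.1) fun p => g (finSigmaFinEquiv ⟨z.1, p⟩)).label z.2 = (g (finSigmaFinEquiv ⟨i, p⟩)).label q := by
      rintro z rfl; exact hr
    exact key _ (Equiv.symm_apply_apply _ _)

theorem graft_not_trivial {m : PTree V ar Unit} (hm : ¬ m.IsTrivial)
    (g : Fin m.numLeaves → PTree V ar L) : ¬ (graft m g).IsTrivial := by
  cases m with
  | leaf => exact (hm trivial).elim
  | node v c => exact fun h => h

/-- Shape and labels together (used in proofs only). -/
def split : PTree V ar M → Σ s : PTree V ar Unit, (Fin s.numLeaves → M)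
  | leaf x => ⟨leaf (), fun _ => x⟩
  | node v c => ⟨node v fun i => (split (c i)).1,
      fun p => (split (c (finSigmaFinEquiv.symm p).1)).2 (finSigmaFinEquiv.symm p).2⟩

/-- Auxiliary to `split` (used in proofs only). -/
def joinSplit (v : V) (F : Fin (ar v) → Σ s : PTree V ar Unit, (Fin s.numLeaves → M)) :
    Σ s : PTree V ar Unit, (Fin s.numLeaves → M) :=
  ⟨node v fun i => (F i).1,
      fun p => (F (finSigmaFinEquiv.symm p).1).2 (finSigmaFinEquiv.symm p).2⟩

theorem shape_label_graft_leaf (m : PTree V ar Unit) (c : Fin m.numLeaves → M) :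
    (⟨(graft m fun p => leaf (c p)).shape, (graft m fun p => leaf (c p)).label⟩ :
      Σ s : PTree V ar Unit, (Fin s.numLeaves → M)) = ⟨m, c⟩ := by
  induction m with
  | leaf x =>
    refine congrArg (Sigma.mk _) ?_
    funext p
    have : p = (0 : Fin 1) := Subsingleton.elim (α := Fin 1) _ _
    subst this; rfl
  | node v d ih =>
    have := congrArg (joinSplit v) (funext fun i => ih i fun p => c (finSigmaFinEquiv ⟨i, p⟩))
    refine Eq.trans this ?_
    simp only [joinSplit, Sigma.eta]
    refine congrArg (Sigma.mk _) ?_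
    funext p
    exact congrArg c (Equiv.apply_symm_apply finSigmaFinEquiv p)
end PTree

namespace DTree
open PTree
variable {V : Type} {ar : V → ℕ} {L : Type}
theorem ofLabelled_eq {N : PTree V ar (DTree V ar L)} (h : ¬ N.IsTrivial) :
    ofLabelled N = .node ⟨N.shape, by cases N with
      | leaf => exact h
      | node => exact fun h => h⟩ N.label := by
  cases N with
  | leaf => exact (h trivial).elim
  | node => rfl

theorem ofLabelled_graft_leaf (m : NTMonomial V ar) (c : Fin m.1.numLeaves → DTree V ar L) :
    ofLabelled (graft m.1 fun p => .leaf (c p)) = .node m c := by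
  rw [ofLabelled_eq (graft_not_trivial m.2 _)]
  have key : ∀ (x : Σ s : PTree V ar Unit, (Fin s.numLeaves → DTree V ar L)) (h : ¬ x.1.IsTrivial),
    x = ⟨m.1, c⟩ → (PTree.node ⟨x.1, h⟩ x.2 : DTree V ar L) = .node m c := by
    rintro x h rfl; rfl
  exact key _ _ (shape_label_graft_leaf m.1 c)

theorem flatten_ofLabelled (N : PTree V ar (DTree V ar L)) :
    flatten (ofLabelled N) = N.bind flatten := by
  cases N with
  | leaf => rfl
  | node v c => exact graft_shape (.node v c) flatten

theorem flatten_contractAt (m : NTMonomial V ar) (c : Fin m.1.numLeaves → DTree V ar L)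
    (p : Fin m.1.numLeaves) (m' : NTMonomial V ar) (c' : Fin m'.1.numLeaves → DTree V ar L)
    (h : c p = .node m' c') : flatten (contractAt m c p m' c') = flatten (.node m c) := by
  rw [contractAt, flatten_ofLabelled, bind_graft, flatten]
  congr 1; funext q
  split_ifs with hq
  · subst hq; rw [bind_graft, h]; rfl
  · rfl

/-- Total number of vertices of the labels (used in proofs only). -/
def weight : PTree V ar (DTree V ar L) → ℕ
  | .leaf T => T.size
  | .node _ c => ∑ i, weight (c i)

theorem sum_label_size (N : PTree V ar (DTree V ar L)) : ∑ p, (N.label p).size = weight N := by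
  induction N with
  | leaf T => exact Fin.sum_univ_one (fun p : Fin 1 => T.size)
  | node v c ih =>
    simp only [weight, ← ih]
    rw [← Fintype.sum_sigma' (f := fun i p => ((c i).label p).size)]
    exact Equiv.sum_comp finSigmaFinEquiv.symm
      (fun z : (i : Fin (ar v)) × Fin (c i).shape.numLeaves => ((c z.1).label z.2).size)

theorem weight_graft (m : PTree V ar Unit) (g : Fin m.numLeaves → PTree V ar (DTree V ar L)) :
    weight (graft m g) = ∑ p, weight (g p) := by
  induction m with
  | leaf T => exact (Fin.sum_univ_one (fun p : Fin 1 => weight (g p))).symm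
  | node v c ih =>
    simp only [graft, weight, ih]
    rw [← Fintype.sum_sigma' (f := fun i p => weight (g (finSigmaFinEquiv ⟨i, p⟩)))]
    exact Equiv.sum_comp finSigmaFinEquiv (fun z => weight (g z))

theorem size_ofLabelled {N : PTree V ar (DTree V ar L)} (h : ¬ N.IsTrivial) :
    (ofLabelled N).size = 1 + weight N := by
  rw [ofLabelled_eq h, size, ← sum_label_size N]

theorem size_contractAt (m : NTMonomial V ar) (c : Fin m.1.numLeaves → DTree V ar L)
    (p : Fin m.1.numLeaves) (m' : NTMonomial V ar) (c' : Fin m'.1.numLeaves → DTree V ar L)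
    (h : c p = .node m' c') : (contractAt m c p m' c').size + 1 = (PTree.node m c : DTree V ar L).size := by
  rw [contractAt, size_ofLabelled (graft_not_trivial m.2 _), weight_graft, size,
    ← Finset.add_sum_erase _ _ (Finset.mem_univ p), ← Finset.add_sum_erase _ _ (Finset.mem_univ p),
    h, if_pos rfl, weight_graft, size]
  have : ∀ q ∈ Finset.univ.erase p, weight (if q = p then graft m'.1 fun r => .leaf (c' r) else .leaf (c q))
    = (c q).size := by
    intro q hq
    rw [if_neg (Finset.ne_of_mem_erase hq)]; rfl
  rw [Finset.sum_congr rfl this]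
  simp only [weight]; omega

end DTree

/-- The tree monomial `t` is divisible by a tree monomial of `R`, i.e. some `r ∈ R` occurs in it as a
subtree: above some place, `t` is obtained from `r` by grafting trees on the leaves of `r`. The span
of these monomials is the operadic ideal generated by `R`. -/
def InIdeal {V : Type} {ar : V → ℕ} (R : Set (PTree V ar Unit)) (t : PTree V ar Unit) : Prop :=
  ∃ r ∈ R, ∃ a f, t.subtreeAt a = some (PTree.graft r f)

theorem InIdeal.graft {V : Type} {ar : V → ℕ} {R : Set (PTree V ar Unit)} {m : PTree V ar Unit}
    (h : InIdeal R m) (g : Fin m.numLeaves → PTree V ar Unit) : InIdeal R (PTree.graft m g) := by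
  obtain ⟨r, hr, a, f, h⟩ := h
  obtain ⟨g', hg⟩ := PTree.subtreeAt_graft m g a _ h
  obtain ⟨f', hf⟩ := PTree.graft_graft r f g'
  exact ⟨r, hr, a, f', by rw [hg, hf]⟩

theorem InIdeal.input {V : Type} {ar : V → ℕ} {R : Set (PTree V ar Unit)} {m : PTree V ar Unit}
    {g : Fin m.numLeaves → PTree V ar Unit} (p : Fin m.numLeaves) (h : InIdeal R (g p)) :
    InIdeal R (PTree.graft m g) := by
  obtain ⟨r, hr, b, f, h⟩ := h
  obtain ⟨a, ha⟩ := PTree.exists_subtreeAt_input m g p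
  exact ⟨r, hr, a ++ b, f, by rw [ha, h]⟩

namespace DTree
open PTree
variable {V : Type} {ar : V → ℕ} {L : Type}

/-- One of the decorations lies in the ideal generated by `R`. -/
def Vanishes (R : Set (PTree V ar Unit)) : DTree V ar L → Prop
  | .leaf _ => False
  | .node m c => InIdeal R m.1 ∨ ∃ p, Vanishes R (c p)

theorem vanishes_contractAt (R : Set (PTree V ar Unit)) (m : NTMonomial V ar)
    (c : Fin m.1.numLeaves → DTree V ar L)
    (p : Fin m.1.numLeaves) (m' : NTMonomial V ar) (c' : Fin m'.1.numLeaves → DTree V ar L)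
    (h : c p = .node m' c') (hv : Vanishes R (.node m c)) :
    Vanishes R (contractAt m c p m' c') := by
  have hN := graft_not_trivial m.2 (fun q => if q = p then graft m'.1 fun r => .leaf (c' r) else .leaf (c q))
  rw [contractAt, ofLabelled_eq hN]
  have hlab : ∀ q r, Vanishes R
      ((if q = p then graft m'.1 fun r => .leaf (c' r) else .leaf (c q)).label r) →
      ∃ s, Vanishes R ((graft m.1 fun q => if q = p then graft m'.1 fun r => .leaf (c' r) else .leaf (c q)).label s) := by
    intro q r hr
    obtain ⟨s, hs⟩ := exists_label_graft m.1 (fun q => if q = p then graft m'.1 fun r => .leaf (c' r) else .leaf (c q)) q r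
    exact ⟨s, by rw [hs]; exact hr⟩
  have hleaf : ∀ (N : PTree V ar (DTree V ar L)) (T : DTree V ar L), N = .leaf T → Vanishes R T →
      ∃ r, Vanishes R (N.label r) := by
    rintro N T rfl hT; exact ⟨(0 : Fin 1), hT⟩
  have hvert : InIdeal R m'.1 → InIdeal R (graft m.1 fun q => if q = p then graft m'.1 fun r => .leaf (c' r) else .leaf (c q)).shape := by
    intro hm'
    rw [shape_graft]
    refine InIdeal.input p ?_
    rw [if_pos rfl, shape_graft]
    exact hm'.graft _
  rcases hv with hm | ⟨q, hq⟩
  · left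
    dsimp only
    rw [shape_graft]
    exact hm.graft _
  · by_cases hqp : q = p
    · subst hqp
      rw [h] at hq
      rcases hq with hm' | ⟨r, hr⟩
      · exact Or.inl (hvert hm')
      · right
        obtain ⟨s, hs⟩ := exists_label_graft m'.1 (fun r => .leaf (c' r)) r (0 : Fin 1)
        have : ∃ r, Vanishes R ((if q = q then graft m'.1 fun r => .leaf (c' r) else .leaf (c q)).label r) := by
          have e : (if q = q then graft m'.1 fun r => .leaf (c' r) else .leaf (c q)) = graft m'.1 fun r => .leaf (c' r) := if_pos rfl
          rw [e]
          exact ⟨s, by rw [hs]; exact hr⟩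
        obtain ⟨t, ht⟩ := this
        exact hlab q t ht
    · right
      obtain ⟨r, hr⟩ := hleaf _ (c q) (if_neg hqp) hq
      exact hlab q r hr

theorem size_update (m : NTMonomial V ar) (c : Fin m.1.numLeaves → DTree V ar L)
    (p : Fin m.1.numLeaves) (T : DTree V ar L) (h : T.size + 1 = (c p).size) :
    (PTree.node m (Function.update c p T) : DTree V ar L).size + 1 =
      (PTree.node m c : DTree V ar L).size := by
  simp only [size]
  rw [← Finset.add_sum_erase _ _ (Finset.mem_univ p), ← Finset.add_sum_erase _ (fun i => (c i).size) (Finset.mem_univ p),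
    Function.update_self]
  have : ∀ q ∈ Finset.univ.erase p, (Function.update c p T q).size = (c q).size := by
    intro q hq
    rw [Function.update_of_ne (Finset.ne_of_mem_erase hq)]
  rw [Finset.sum_congr rfl this]
  omega

theorem flatten_update (m : NTMonomial V ar) (c : Fin m.1.numLeaves → DTree V ar L)
    (p : Fin m.1.numLeaves) (T : DTree V ar L) (h : flatten T = flatten (c p)) :
    flatten (.node m (Function.update c p T)) = flatten (.node m c) := by
  simp only [flatten]
  congr 1; funext q
  by_cases hq : q = p
  · subst hq; simpa using h
  · rw [Function.update_of_ne hq]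

theorem vanishes_update (R : Set (PTree V ar Unit)) (m : NTMonomial V ar) (c : Fin m.1.numLeaves → DTree V ar L)
    (p : Fin m.1.numLeaves) (T : DTree V ar L) (h : Vanishes R (c p) → Vanishes R T)
    (hv : Vanishes R (.node m c)) :
    Vanishes R (.node m (Function.update c p T)) := by
  rcases hv with hm | ⟨q, hq⟩
  · exact Or.inl hm
  · refine Or.inr ⟨q, ?_⟩
    by_cases hqp : q = p
    · subst hqp; simpa using h hq
    · rwa [Function.update_of_ne hqp]

theorem mapDomain_mem_supported {k α β : Type*} [Field k] (f : α → β) {s : Set α} {t : Set β}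
    (h : ∀ a ∈ s, f a ∈ t) {x : α →₀ k} (hx : x ∈ Finsupp.supported k k s) :
    x.mapDomain f ∈ Finsupp.supported k k t := by
  classical
  rw [Finsupp.mem_supported] at hx ⊢
  intro b hb
  obtain ⟨a, ha, rfl⟩ := Finset.mem_image.mp (Finsupp.mapDomain_support hb)
  exact h a (hx ha)

theorem barDiff_mem (k : Type*) [Field k] (T : DTree V ar L) :
    barDiff k T ∈ Finsupp.supported k k {T' : DTree V ar L | flatten T' = flatten T ∧
      T'.size + 1 = T.size ∧ ∀ R, Vanishes R T → Vanishes R T'} := by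
  induction T with
  | leaf l => exact Submodule.zero_mem _
  | node m c ih =>
    rw [barDiff]
    refine Submodule.sum_mem _ fun p _ => Submodule.smul_mem _ _ (Submodule.sub_mem _ ?_ ?_)
    · cases h : c p with
      | leaf l => exact Submodule.zero_mem _
      | node m' c' =>
        exact Finsupp.single_mem_supported k _ ⟨flatten_contractAt m c p m' c' h,
          size_contractAt m c p m' c' h, fun R => vanishes_contractAt R m c p m' c' h⟩
    · refine mapDomain_mem_supported _ ?_ (ih p)
      rintro T ⟨h1, h2, h3⟩
      exact ⟨flatten_update m c p T h1, size_update m c p T h2,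
        fun R => vanishes_update R m c p T (h3 R)⟩

/-- Used in the proof that the differential squares to zero only. -/
noncomputable def expand (k : Type*) [Field k] : DTree V ar L → (PTree V ar (DTree V ar L) →₀ k)
  | .leaf _ => 0
  | .node m c => Finsupp.single (graft m.1 fun p => .leaf (c p)) 1

/-- Used in the proof that the differential squares to zero only. -/
noncomputable def labDiff (k : Type*) [Field k] :
    PTree V ar (DTree V ar L) → (PTree V ar (DTree V ar L) →₀ k)
  | .leaf T => expand k T - (barDiff k T).mapDomain .leaf
  | .node v c => ∑ i, (-1 : k) ^ (∑ q ∈ Finset.Iio i, weight (c q)) •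
      (labDiff k (c i)).mapDomain fun X => .node v (Function.update c i X)

theorem finSigma_lt {n : ℕ} (a : Fin n → ℕ) {i j : Fin n} (h : j < i) (p : Fin (a i))
    (q : Fin (a j)) :
    (finSigmaFinEquiv ⟨j, q⟩ : Fin (∑ i, a i)) < finSigmaFinEquiv ⟨i, p⟩ := by
  have key : ∀ i : Fin n, ∑ x : Fin i.val, a (Fin.castLE i.2.le x) = ∑ x ∈ Finset.Iio i, a x := by
    intro i
    refine Finset.sum_bij (fun x _ => Fin.castLE i.2.le x) ?_ ?_ ?_ ?_
    · intro x _; simp [Fin.lt_def]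
    · intro x _ y _ hxy; simpa using hxy
    · intro x hx; exact ⟨⟨x, Fin.lt_def.mp (Finset.mem_Iio.mp hx)⟩, Finset.mem_univ _, rfl⟩
    · intro x _; rfl
  rw [Fin.lt_def, finSigmaFinEquiv_apply, finSigmaFinEquiv_apply]
  dsimp only
  rw [key, key]
  have h1 : ∑ x ∈ Finset.Iic j, a x ≤ ∑ x ∈ Finset.Iio i, a x :=
    Finset.sum_le_sum_of_subset (fun x hx => by simp at hx ⊢; exact lt_of_le_of_lt hx h)
  have h2 : ∑ x ∈ Finset.Iic j, a x = ∑ x ∈ Finset.Iio j, a x + a j := by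
    rw [← Finset.Iio_insert, Finset.sum_insert (by simp), add_comm]
  have := q.2
  omega

theorem finSigma_lt_iff {n : ℕ} (a : Fin n → ℕ) (i j : Fin n) (p : Fin (a i)) (q : Fin (a j)) :
    (finSigmaFinEquiv ⟨j, q⟩ : Fin (∑ i, a i)) < finSigmaFinEquiv ⟨i, p⟩ ↔
      j < i ∨ ∃ h : j = i, h ▸ q < p := by
  rcases lt_trichotomy j i with h | h | h
  · simp [finSigma_lt a h p q, h]
  · subst h
    simp only [lt_irrefl, exists_true_left, false_or]
    rw [Fin.lt_def, finSigmaFinEquiv_apply, finSigmaFinEquiv_apply]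
    simp
  · have := finSigma_lt a h q p
    simp only [not_lt_of_gt this, not_lt_of_gt h, h.ne', IsEmpty.exists_iff, or_self]

theorem sum_Iio_sigma {n : ℕ} (a : Fin n → ℕ) (F : Fin (∑ i, a i) → ℕ) (i : Fin n) (p : Fin (a i)) :
    ∑ q ∈ Finset.Iio (finSigmaFinEquiv ⟨i, p⟩), F q =
      ∑ j ∈ Finset.Iio i, ∑ q, F (finSigmaFinEquiv ⟨j, q⟩) +
      ∑ q ∈ Finset.Iio p, F (finSigmaFinEquiv ⟨i, q⟩) := by
  have e1 : ∀ {m : ℕ} (x : Fin m) (G : Fin m → ℕ), ∑ q ∈ Finset.Iio x, G q =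
      ∑ q, if q < x then G q else 0 := by
    intro m x G
    rw [← Finset.sum_filter]; congr 1; ext; simp
  rw [e1, e1, e1, ← Equiv.sum_comp finSigmaFinEquiv, Fintype.sum_sigma]
  have : (∑ q, if q < p then F (finSigmaFinEquiv ⟨i, q⟩) else 0) =
      ∑ j, if h : j = i then (∑ q, if q < p then F (finSigmaFinEquiv ⟨i, q⟩) else 0) else 0 := by
    simp
  rw [this, ← Finset.sum_add_distrib]
  refine Finset.sum_congr rfl fun j _ => ?_
  by_cases h : j = i
  · subst h
    simp [finSigma_lt_iff]
  · simp only [finSigma_lt_iff, h, IsEmpty.exists_iff, or_false]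
    simp

theorem update_sigma {X : Type*} {n : ℕ} {a : Fin n → ℕ} (g : Fin (∑ i, a i) → X) (i : Fin n)
    (p : Fin (a i)) (x : X) (q : Fin (a i)) :
    Function.update g (finSigmaFinEquiv ⟨i, p⟩) x (finSigmaFinEquiv ⟨i, q⟩) =
      Function.update (fun q => g (finSigmaFinEquiv ⟨i, q⟩)) p x q := by
  by_cases hq : q = p
  · subst hq; simp
  · rw [Function.update_of_ne hq, Function.update_of_ne]
    intro h; apply hq; simpa using h

theorem update_sigma_ne {X : Type*} {n : ℕ} {a : Fin n → ℕ} (g : Fin (∑ i, a i) → X) (i : Fin n)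
    (p : Fin (a i)) (x : X) (j : Fin n) (h : j ≠ i) (q : Fin (a j)) :
    Function.update g (finSigmaFinEquiv ⟨i, p⟩) x (finSigmaFinEquiv ⟨j, q⟩) =
      g (finSigmaFinEquiv ⟨j, q⟩) := by
  rw [Function.update_of_ne]
  intro h'; apply h
  exact congrArg Sigma.fst (finSigmaFinEquiv.injective h')

theorem update_graft (v : V) (d : Fin (ar v) → PTree V ar Unit)
    (g : Fin (PTree.node v d).numLeaves → PTree V ar L) (i : Fin (ar v)) (p : Fin (d i).numLeaves)
    (X : PTree V ar L) :
    graft (.node v d) (Function.update g (finSigmaFinEquiv ⟨i, p⟩) X) =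
      .node v (Function.update (fun j => graft (d j) fun q => g (finSigmaFinEquiv ⟨j, q⟩)) i
        (graft (d i) (Function.update (fun q => g (finSigmaFinEquiv ⟨i, q⟩)) p X))) := by
  simp only [graft]
  congr 1; funext j
  by_cases hj : j = i
  · subst hj
    rw [Function.update_self]
    congr 1; funext q
    exact update_sigma (X := PTree V ar L) g j p X q
  · rw [Function.update_of_ne hj]
    congr 1; funext q
    exact update_sigma_ne (X := PTree V ar L) g i p X j hj q

theorem labDiff_graft (k : Type*) [Field k] (m : PTree V ar Unit)
    (g : Fin m.numLeaves → PTree V ar (DTree V ar L)) :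
    labDiff k (graft m g) = ∑ p, (-1 : k) ^ (∑ q ∈ Finset.Iio p, weight (g q)) •
      (labDiff k (g p)).mapDomain fun X => graft m (Function.update g p X) := by
  induction m with
  | leaf x =>
    refine Eq.symm ((Fin.sum_univ_one (fun p : Fin 1 => (-1 : k) ^ (∑ q ∈ Finset.Iio p, weight (g q)) •
      (labDiff k (g p)).mapDomain fun X => graft (.leaf x) (Function.update g p X))).trans ?_)
    have h1 : (Finset.Iio (0 : Fin 1)) = ∅ := by decide
    rw [h1, Finset.sum_empty, pow_zero, one_smul]
    have : (fun X => graft (.leaf x : PTree V ar Unit) (Function.update g (0 : Fin 1) X)) = id := by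
      funext X; exact Function.update_self (β := fun _ : Fin 1 => PTree V ar (DTree V ar L)) 0 X g
    rw [this, Finsupp.mapDomain_id]; rfl
  | node v d ih =>
    refine Eq.symm ((Equiv.sum_comp finSigmaFinEquiv (fun p => (-1 : k) ^ (∑ q ∈ Finset.Iio p, weight (g q)) •
      (labDiff k (g p)).mapDomain fun X => graft (.node v d) (Function.update g p X))).symm.trans ?_)
    rw [Fintype.sum_sigma]
    symm
    change labDiff k (.node v fun i => graft (d i) fun p => g (finSigmaFinEquiv ⟨i, p⟩)) = _
    rw [labDiff]
    refine Finset.sum_congr rfl fun i _ => ?_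
    rw [ih, Finsupp.mapDomain_finsetSum, Finset.smul_sum]
    refine Finset.sum_congr rfl fun p _ => ?_
    rw [Finsupp.mapDomain_smul, smul_smul, ← pow_add, ← Finsupp.mapDomain_comp]
    have hs := sum_Iio_sigma (fun i => (d i).numLeaves) (fun q => weight (g q)) i p
    refine congrArg₂ (fun a b => (-1 : k) ^ a • b) ?_ ?_
    · refine (hs.trans ?_).symm
      exact congrArg₂ (· + ·) (Finset.sum_congr rfl fun j _ => (weight_graft _ _).symm) rfl
    · refine congrArg (fun f => Finsupp.mapDomain f _) ?_
      funext X
      exact (update_graft v d g i p X).symm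

theorem barDiff_node (k : Type*) [Field k] (m : NTMonomial V ar) (c : Fin m.1.numLeaves → DTree V ar L) :
    barDiff k (.node m c) = (labDiff k (graft m.1 fun p => .leaf (c p))).mapDomain ofLabelled := by
  rw [labDiff_graft, Finsupp.mapDomain_finsetSum, barDiff]
  refine Finset.sum_congr rfl fun p _ => ?_
  rw [Finsupp.mapDomain_smul]
  congr 1
  rw [← Finsupp.mapDomain_comp, labDiff, Finsupp.mapDomain_sub, ← Finsupp.mapDomain_comp]
  congr 1
  · cases h : c p with
    | leaf l => simp [expand, contractInput]
    | node m' c' =>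
      simp only [expand, contractInput, Finsupp.mapDomain_single, Function.comp, contractAt]
      congr 3; funext q
      by_cases hq : q = p
      · subst hq; simp
      · simp [hq]
  · congr 1; funext T
    simp only [Function.comp]
    rw [← ofLabelled_graft_leaf]
    congr 2; funext q
    by_cases hq : q = p
    · subst hq; simp
    · simp [hq]


theorem mapDomain_congr_mem {k α β : Type*} [Field k] {f g : α → β} {s : Set α} {x : α →₀ k}
    (hx : x ∈ Finsupp.supported k k s) (h : ∀ a ∈ s, f a = g a) :
    x.mapDomain f = x.mapDomain g :=
  Finsupp.mapDomain_congr fun a ha => h a (hx ha)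

theorem lin_mapDomain {k α β M : Type*} [Field k] [AddCommGroup M] [Module k M] (f : α → β)
    (φ : β → M) (x : α →₀ k) :
    Finsupp.linearCombination k φ (x.mapDomain f) = Finsupp.linearCombination k (fun a => φ (f a)) x := by
  rw [Finsupp.linearCombination_mapDomain]; rfl

theorem lin_congr {k α M : Type*} [Field k] [AddCommGroup M] [Module k M] {φ ψ : α → M}
    {s : Set α} {x : α →₀ k} (hx : x ∈ Finsupp.supported k k s) (h : ∀ a ∈ s, φ a = ψ a) :
    Finsupp.linearCombination k φ x = Finsupp.linearCombination k ψ x := by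
  rw [Finsupp.linearCombination_apply, Finsupp.linearCombination_apply]
  exact Finsupp.sum_congr fun a ha => by rw [h a (hx ha)]

theorem weight_update (v : V) (c : Fin (ar v) → PTree V ar (DTree V ar L)) (i : Fin (ar v))
    (X : PTree V ar (DTree V ar L)) (h : weight X + 1 = weight (c i)) :
    weight (.node v (Function.update c i X)) + 1 = weight (.node v c) := by
  simp only [weight]
  rw [← Finset.add_sum_erase _ _ (Finset.mem_univ i),
    ← Finset.add_sum_erase _ (fun i => weight (c i)) (Finset.mem_univ i), Function.update_self]
  have : ∀ q ∈ Finset.univ.erase i, weight (Function.update c i X q) = weight (c q) := by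
    intro q hq
    rw [Function.update_of_ne (Finset.ne_of_mem_erase hq)]
  rw [Finset.sum_congr rfl this]
  omega

theorem labDiff_mem (k : Type*) [Field k] (N : PTree V ar (DTree V ar L)) :
    labDiff k N ∈ Finsupp.supported k k {X : PTree V ar (DTree V ar L) |
      weight X + 1 = weight N ∧ (¬ N.IsTrivial → ¬ X.IsTrivial)} := by
  induction N with
  | leaf T =>
    rw [labDiff]
    refine Submodule.sub_mem _ ?_ ?_
    · cases T with
      | leaf l => exact Submodule.zero_mem _
      | node m c =>
        refine Finsupp.single_mem_supported k _ ⟨?_, fun h => (h trivial).elim⟩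
        rw [weight_graft]; simp only [weight, size]; omega
    · refine mapDomain_mem_supported _ ?_ (barDiff_mem k T)
      rintro T' ⟨-, h, -⟩
      exact ⟨h, fun h => (h trivial).elim⟩
  | node v c ih =>
    rw [labDiff]
    refine Submodule.sum_mem _ fun i _ => Submodule.smul_mem _ _ ?_
    refine mapDomain_mem_supported _ ?_ (ih i)
    rintro X ⟨h, -⟩
    exact ⟨weight_update v c i X h, fun _ h => h⟩

theorem barDiff_ofLabelled (k : Type*) [Field k] {N : PTree V ar (DTree V ar L)}
    (h : ¬ N.IsTrivial) : barDiff k (ofLabelled N) = (labDiff k N).mapDomain ofLabelled := by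
  rw [ofLabelled_eq h, barDiff_node]
  congr 2
  rw [graft_shape, bind_leaf]

theorem expand_ofLabelled (k : Type*) [Field k] {N : PTree V ar (DTree V ar L)}
    (h : ¬ N.IsTrivial) : expand k (ofLabelled N) = Finsupp.single N 1 := by
  rw [ofLabelled_eq h, expand]
  congr 1
  rw [graft_shape, bind_leaf]

/-- Used in the proof that the differential squares to zero only. -/
noncomputable def pairSum (k : Type*) [Field k] (v : V) (c : Fin (ar v) → PTree V ar (DTree V ar L))
    (i j : Fin (ar v)) : PTree V ar (DTree V ar L) →₀ k :=
  Finsupp.linearCombination k (fun X => (labDiff k (c j)).mapDomain fun Y =>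
    .node v (Function.update (Function.update c i X) j Y)) (labDiff k (c i))

theorem pairSum_comm (k : Type*) [Field k] (v : V) (c : Fin (ar v) → PTree V ar (DTree V ar L))
    {i j : Fin (ar v)} (h : i ≠ j) : pairSum k v c i j = pairSum k v c j i := by
  simp only [pairSum, Finsupp.linearCombination_apply, Finsupp.mapDomain, Finsupp.smul_sum]
  rw [Finsupp.sum_comm]
  refine Finsupp.sum_congr fun Y _ => Finsupp.sum_congr fun X _ => ?_
  rw [Function.update_comm h, Finsupp.smul_single, Finsupp.smul_single, smul_eq_mul, smul_eq_mul,
    mul_comm]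

theorem labDiff_sq_node (k : Type*) [Field k] (v : V) (c : Fin (ar v) → PTree V ar (DTree V ar L))
    (h : ∀ i, Finsupp.linearCombination k (labDiff k) (labDiff k (c i)) = 0) :
    Finsupp.linearCombination k (labDiff k) (labDiff k (.node v c)) = 0 := by
  set s : Fin (ar v) → k := fun i => (-1 : k) ^ (∑ q ∈ Finset.Iio i, weight (c q)) with hs
  have hss : ∀ i, s i * s i = 1 := fun i => by
    rw [hs]; simp only; rw [← mul_pow]; simp
  have e : ∀ i, Finsupp.linearCombination k (labDiff k)
      ((labDiff k (c i)).mapDomain fun X => .node v (Function.update c i X)) =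
      ∑ j, if j = i then 0 else (if i < j then -s j else s j) • pairSum k v c i j := by
    intro i
    rw [lin_mapDomain]
    have h1 : ∀ X ∈ {X : PTree V ar (DTree V ar L) | weight X + 1 = weight (c i) ∧
        (¬ (c i).IsTrivial → ¬ X.IsTrivial)},
        labDiff k (.node v (Function.update c i X)) =
        ∑ j, if j = i then s i • (labDiff k X).mapDomain (fun Y => .node v (Function.update c i Y))
          else (if i < j then -s j else s j) • ((labDiff k (c j)).mapDomain fun Y =>
            .node v (Function.update (Function.update c i X) j Y)) := by
      rintro X ⟨hX, -⟩
      rw [labDiff]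
      refine Finset.sum_congr rfl fun j _ => ?_
      by_cases hj : j = i
      · subst hj
        rw [if_pos rfl, Function.update_self]
        congr 2
        · refine Finset.sum_congr rfl fun q hq => ?_
          rw [Function.update_of_ne (Finset.mem_Iio.mp hq).ne]
        · funext Y; rw [Function.update_idem]
      · rw [if_neg hj, Function.update_of_ne hj]
        congr 1
        split_ifs with hij
        · rw [hs]; dsimp only
          have hi : i ∈ Finset.Iio j := Finset.mem_Iio.mpr hij
          rw [← Finset.add_sum_erase _ _ hi,
            ← Finset.add_sum_erase _ (fun q => weight (c q)) hi, Function.update_self, ← hX]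
          have : ∀ q ∈ (Finset.Iio j).erase i, weight (Function.update c i X q) = weight (c q) := by
            intro q hq
            rw [Function.update_of_ne (Finset.ne_of_mem_erase hq)]
          rw [Finset.sum_congr rfl this, add_right_comm, pow_succ]; ring
        · rw [hs]; dsimp only
          congr 1
          refine Finset.sum_congr rfl fun q hq => ?_
          rw [Function.update_of_ne]
          rintro rfl; exact hij (Finset.mem_Iio.mp hq)
    rw [lin_congr (labDiff_mem k (c i)) h1]
    have h2 : ∀ (ψ : Fin (ar v) → PTree V ar (DTree V ar L) → (PTree V ar (DTree V ar L) →₀ k)) x,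
        Finsupp.linearCombination k (fun X => ∑ j, ψ j X) x =
          ∑ j, Finsupp.linearCombination k (ψ j) x := by
      intro ψ x
      simp only [Finsupp.linearCombination_apply, Finset.smul_sum, Finsupp.sum]
      exact Finset.sum_comm
    rw [h2]
    refine Finset.sum_congr rfl fun j _ => ?_
    by_cases hj : j = i
    · subst hj
      simp only [if_true]
      have := congrArg (fun y => s j • Finsupp.mapDomain (fun Y => PTree.node v (Function.update c j Y)) y) (h j)
      simp only [Finsupp.mapDomain_zero, smul_zero] at this
      rw [← this, Finsupp.linearCombination_apply, Finsupp.linearCombination_apply, Finsupp.sum,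
        Finsupp.sum, Finsupp.mapDomain_finsetSum, Finset.smul_sum]
      refine Finset.sum_congr rfl fun X _ => ?_
      rw [Finsupp.mapDomain_smul, smul_comm]
    · simp only [hj, if_false, pairSum]
      rw [Finsupp.linearCombination_apply, Finsupp.linearCombination_apply, Finsupp.smul_sum]
      exact Finsupp.sum_congr fun X _ => smul_comm _ _ _
  rw [labDiff, map_sum]
  simp only [map_smul, e, Finset.smul_sum]
  rw [← Fintype.sum_prod_type' (f := fun i j => (-1 : k) ^ (∑ q ∈ Finset.Iio i, weight (c q)) •
    if j = i then 0 else (if i < j then -s j else s j) • pairSum k v c i j)]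
  refine Finset.sum_involution (fun x _ => (x.2, x.1)) ?_ ?_ (fun _ _ => Finset.mem_univ _)
    (fun _ _ => rfl)
  · rintro ⟨i, j⟩ -
    change s i • _ + s j • _ = 0
    dsimp only
    by_cases hij : j = i
    · simp [hij]
    · rw [if_neg hij, if_neg (Ne.symm hij), pairSum_comm k v c hij, smul_smul, smul_smul, ← add_smul]
      have : s i * (if i < j then -s j else s j) + s j * (if j < i then -s i else s i) = 0 := by
        rcases lt_or_gt_of_ne hij with h | h
        · simp [h, h.not_gt]; ring
        · simp [h, h.not_gt]; ring
      rw [this, zero_smul]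
  · rintro ⟨i, j⟩ - hne heq
    apply hne
    have : j = i := congrArg Prod.fst heq
    simp [this]

theorem labDiff_sq_graft (k : Type*) [Field k] (m : PTree V ar Unit)
    (g : Fin m.numLeaves → PTree V ar (DTree V ar L))
    (h : ∀ p, Finsupp.linearCombination k (labDiff k) (labDiff k (g p)) = 0) :
    Finsupp.linearCombination k (labDiff k) (labDiff k (graft m g)) = 0 := by
  induction m with
  | leaf x => exact h (0 : Fin 1)
  | node v d ih => exact labDiff_sq_node k v _ fun i => ih i _ fun p => h _

theorem labDiff_sq_leaf (k : Type*) [Field k] (T : DTree V ar L)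
    (h : Finsupp.linearCombination k (barDiff k) (barDiff k T) = 0) :
    Finsupp.linearCombination k (labDiff k) (labDiff k (.leaf T)) = 0 := by
  rw [labDiff, map_sub, lin_mapDomain]
  have hl : Finsupp.linearCombination k (fun T : DTree V ar L => labDiff k (.leaf T)) (barDiff k T) =
      Finsupp.linearCombination k (expand k) (barDiff k T) := by
    have : (Finsupp.linearCombination k (barDiff k) (barDiff k T)).mapDomain
        (PTree.leaf : _ → PTree V ar (DTree V ar L)) = 0 := by rw [h]; simp
    rw [← sub_zero (Finsupp.linearCombination k (expand k) (barDiff k T)), ← this]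
    simp only [Finsupp.linearCombination_apply, Finsupp.sum, Finsupp.mapDomain_finsetSum,
      ← Finset.sum_sub_distrib, labDiff, smul_sub, Finsupp.mapDomain_smul]
  rw [hl]
  cases T with
  | leaf l => simp [expand, barDiff]
  | node m c =>
    have hm := graft_not_trivial m.2 (fun p => PTree.leaf (V := V) (ar := ar) (c p))
    rw [barDiff_node, lin_mapDomain, expand, Finsupp.linearCombination_single, one_smul]
    rw [lin_congr (ψ := fun N => Finsupp.single N (1 : k)) (labDiff_mem k _)
      (fun N hN => expand_ofLabelled k (hN.2 hm))]
    rw [Finsupp.linearCombination_apply]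
    simp

theorem barDiff_sq (k : Type*) [Field k] (T : DTree V ar L) :
    Finsupp.linearCombination k (barDiff k) (barDiff k T) = 0 := by
  induction T with
  | leaf l => simp [barDiff]
  | node m c ih =>
    have hm := graft_not_trivial m.2 (fun p => PTree.leaf (V := V) (ar := ar) (c p))
    have hz := labDiff_sq_graft k m.1 (fun p => .leaf (c p)) fun p => labDiff_sq_leaf k _ (ih p)
    rw [barDiff_node, lin_mapDomain, lin_congr (labDiff_mem k _)
      (fun N hN => barDiff_ofLabelled k (hN.2 hm))]
    have := congrArg (Finsupp.mapDomain ofLabelled) hz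
    rw [Finsupp.mapDomain_zero] at this
    rw [← this]
    simp only [Finsupp.linearCombination_apply, Finsupp.sum, Finsupp.mapDomain_finsetSum,
      Finsupp.mapDomain_smul]

end DTree

/-- A monomial operad: finitely many generators, each with an arity, and finitely many relations which
are (nontrivial) tree monomials. The operad is the quotient of the free operad on the generators by the
ideal generated by the relations; its standard basis is the set of tree monomials which are not
divisible by a relation. -/
structure MonomialOperad where
  gen : Type
  finite_gen : Finite gen
  arity : gen → ℕ
  rel : Set (PTree gen arity Unit)
  finite_rel : rel.Finite
  rel_nontrivial : ∀ r ∈ rel, ¬ r.IsTrivial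

namespace MonomialOperad

/-- The tree monomials, with leaves labelled by `L`, in the generators of `P`. -/
abbrev Monomial (P : MonomialOperad) (L : Type) : Type := PTree P.gen P.arity L

/-- The kernel of the map from the bar construction of the free operad to the bar construction of `P`:
the span of the decorated trees with a decoration that is zero in `P`. -/
noncomputable def barKernel (k : Type*) [Field k] (P : MonomialOperad) (L : Type) :
    Submodule k (DTree P.gen P.arity L →₀ k) :=
  Finsupp.supported k k {T | T.Vanishes P.rel}

/-- The bar construction of the monomial operad `P`. It has as basis the trees decorated by nontrivial
tree monomials which are nonzero in `P`. -/
abbrev Bar (k : Type*) [Field k] (P : MonomialOperad) (L : Type) : Type _ :=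
  (DTree P.gen P.arity L →₀ k) ⧸ barKernel k P L

theorem barKernel_le (k : Type*) [Field k] (P : MonomialOperad) (L : Type) :
    barKernel k P L ≤ (barKernel k P L).comap
      (Finsupp.linearCombination k (DTree.barDiff (L := L) k)) := by
  intro x hx
  rw [Submodule.mem_comap, Finsupp.linearCombination_apply]
  refine Submodule.sum_mem _ fun T hT => Submodule.smul_mem _ _ ?_
  exact Finsupp.supported_mono (fun T' hT' => hT'.2.2 P.rel (hx hT)) (DTree.barDiff_mem k T)

/-- The differential of the bar construction of `P`. -/
noncomputable def barD (k : Type*) [Field k] (P : MonomialOperad) (L : Type) :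
    Bar k P L →ₗ[k] Bar k P L :=
  Submodule.mapQ _ _ (Finsupp.linearCombination k (DTree.barDiff k)) (barKernel_le k P L)

theorem barD_barD (k : Type*) [Field k] (P : MonomialOperad) (L : Type) (x : Bar k P L) :
    barD k P L (barD k P L x) = 0 := by
  obtain ⟨x, rfl⟩ := Submodule.mkQ_surjective _ x
  simp only [barD, Submodule.mkQ_apply, Submodule.mapQ_apply]
  rw [show Finsupp.linearCombination k (DTree.barDiff k)
    (Finsupp.linearCombination k (DTree.barDiff k) x) = 0 from ?_, Submodule.Quotient.mk_zero]
  rw [Finsupp.linearCombination_apply k x, Finsupp.sum, map_sum]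
  refine Finset.sum_eq_zero fun T _ => ?_
  rw [map_smul, DTree.barDiff_sq, smul_zero]

/-- The part of the bar construction spanned by the decorated trees whose total composition is the tree
monomial `w` and which are obtained from `w` by performing `j` compositions, so that they have
`w.size - j` vertices. -/
noncomputable def barPiece (k : Type*) [Field k] (P : MonomialOperad) {L : Type} (w : P.Monomial L) (j : ℕ) :
    Submodule k (Bar k P L) :=
  (Finsupp.supported k k {T | DTree.flatten T = w ∧ T.size + j = w.size}).map (barKernel k P L).mkQ

theorem barD_mem (k : Type*) [Field k] (P : MonomialOperad) {L : Type} (w : P.Monomial L) (j : ℕ) :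
    ∀ x ∈ barPiece k P w j, barD k P L x ∈ barPiece k P w (j + 1) := by
  rintro _ ⟨x, hx, rfl⟩
  refine ⟨Finsupp.linearCombination k (DTree.barDiff k) x, ?_, rfl⟩
  rw [Finsupp.linearCombination_apply]
  refine Submodule.sum_mem _ fun T hT => Submodule.smul_mem _ _ ?_
  refine Finsupp.supported_mono (fun T' hT' => ?_) (DTree.barDiff_mem k T)
  obtain ⟨h1, h2⟩ := hx hT
  obtain ⟨h3, h4, -⟩ := hT'
  exact ⟨h3.trans h1, by omega⟩

/-- The complex `B_w`: the subcomplex of the bar construction of `P` formed by the decorated trees with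
total composition `w`, graded by the number of compositions which have been performed. -/
noncomputable def barComplex (k : Type*) [Field k] (P : MonomialOperad) {L : Type}
    (w : P.Monomial L) : CochainComplex (ModuleCat k) ℕ :=
  CochainComplex.of (fun j => ModuleCat.of k (barPiece k P w j))
    (fun j => ModuleCat.ofHom ((barD k P L).restrict (barD_mem k P w j)))
    (fun j => by
      refine ModuleCat.hom_ext (LinearMap.ext fun x => Subtype.ext ?_)
      exact (barD_barD k P L x.1))

/-- The sets of internal edges of `w` which are covered by the occurrences in `w` of the relations of
`P` as subtrees. -/
def relationSets (P : MonomialOperad) {L : Type} (w : P.Monomial L) : Set (Finset w.edges) :=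
  {S | ∃ r ∈ P.rel, ∃ a f, w.subtreeAt a = some (PTree.graft r f) ∧
    S.image Subtype.val = r.edges.image fun b => a ++ b}

end MonomialOperad

namespace Grassmann

variable (k : Type*) [Field k] (ι : Type)

/-- The generator `x_i` of the Grassmann (exterior) algebra on the variables `x_i`, `i : ι`. -/
noncomputable def gen (i : ι) : ExteriorAlgebra k (ι →₀ k) :=
  ExteriorAlgebra.ι k (Finsupp.single i 1)

/-- The monomial which is the product of the variables in `S`, in some order (another order changes at
most its sign). -/
noncomputable def monomial (S : Finset ι) : ExteriorAlgebra k (ι →₀ k) :=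
  (S.toList.map (gen k ι)).prod

/-- The two-sided ideal generated by the monomials given by the sets in `R`. -/
noncomputable def monomialIdeal (R : Set (Finset ι)) : Ideal (ExteriorAlgebra k (ι →₀ k)) :=
  (TwoSidedIdeal.span (monomial k ι '' R)).asIdeal

instance (R : Set (Finset ι)) : (monomialIdeal k ι R).IsTwoSided := by
  unfold monomialIdeal; infer_instance

/-- The monomial quotient of the Grassmann algebra. -/
abbrev QuotientAlgebra (R : Set (Finset ι)) : Type _ := ExteriorAlgebra k (ι →₀ k) ⧸ monomialIdeal k ι R

/-- The component of degree `j` of the quotient: the image of the elements of degree `j`. -/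
noncomputable def piece (R : Set (Finset ι)) (j : ℕ) : Submodule k (QuotientAlgebra k ι R) :=
  (⋀[k]^j (ι →₀ k)).map (Ideal.Quotient.mkₐ k (monomialIdeal k ι R)).toLinearMap

variable [Fintype ι]

/-- The differential `u ↦ u (x_1 + ... + x_n)`. -/
noncomputable def d (R : Set (Finset ι)) : QuotientAlgebra k ι R →ₗ[k] QuotientAlgebra k ι R :=
  LinearMap.mulRight k (Ideal.Quotient.mk (monomialIdeal k ι R) (∑ i, gen k ι i))

theorem d_d (R : Set (Finset ι)) (x : QuotientAlgebra k ι R) : d k ι R (d k ι R x) = 0 := by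
  have h : (∑ i, gen k ι i) * (∑ i, gen k ι i) = 0 := by
    simp only [gen, ← map_sum]
    exact ExteriorAlgebra.ι_sq_zero _
  simp only [d, LinearMap.mulRight_apply, mul_assoc]
  rw [← map_mul, h, map_zero, mul_zero]

theorem d_mem (R : Set (Finset ι)) (j : ℕ) :
    ∀ x ∈ piece k ι R j, d k ι R x ∈ piece k ι R (j + 1) := by
  rintro _ ⟨x, hx, rfl⟩
  refine ⟨x * ∑ i, gen k ι i, ?_, ?_⟩
  · have hg : ∑ i, gen k ι i ∈ LinearMap.range (ExteriorAlgebra.ι k (M := ι →₀ k)) :=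
      Submodule.sum_mem _ fun i _ => ⟨_, rfl⟩
    have h := Submodule.mul_mem_mul hx hg
    rwa [← pow_succ] at h
  · simp [d]

/-- The complex given by a monomial quotient of the Grassmann algebra, with its grading and the
differential `u ↦ u (x_1 + ... + x_n)`. -/
noncomputable def complex (R : Set (Finset ι)) : CochainComplex (ModuleCat k) ℕ :=
  CochainComplex.of (fun j => ModuleCat.of k (piece k ι R j))
    (fun j => ModuleCat.ofHom ((d k ι R).restrict (d_mem k ι R j)))
    (fun j => by
      refine ModuleCat.hom_ext (LinearMap.ext fun x => Subtype.ext ?_)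
      exact (d_d k ι R x.1))

end Grassmann

/-! Both complexes are cube complexes on the subsets of `X`, the set of internal edges of `w`. A
decorated tree with total composition `w` amounts to a cutting of `w` into connected pieces, hence
to the set `S` of edges that are not cut: `contract S w` is that tree. This is a bijection by
`flatten_contract`, `contract_inj` and `exists_contract_flatten`. The degree is the cardinality of
`S` (`size_contract_add_card`). A decoration vanishes in the operad exactly when a relation occurs
in `w` with all its edges in `S` (`vanishes_contract`). The bar differential sends `S` to a
combination, with nonzero coefficients, of the sets obtained by adding one edge
(`barDiff_contract`).

On the Grassmann side, the products of distinct variables are a basis indexed by the same subsets,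
the ideal is spanned by the products divisible by a generator (`mem_monomialIdeal_iff`), and
multiplication by the sum of the variables again adds one element, with nonzero coefficients
(`exists_basis_mul_sum_gen`).

It remains to match the coefficients, and this needs no computation of signs. Each differential
squares to zero, so its coefficients anticommute around every square of the cube
(`cube_coefficients_anticomm`). Their quotient therefore commutes around squares, and a
multiplicative 1-cocycle on a cube is a coboundary (`exists_rescaling`). Rescaling the basis gives
an isomorphism of complexes (`exists_isIso_of_cube`), which is stronger than a quasi-isomorphism.

For the converse, `w` is a root vertex of arity `n` with a unary vertex on every input, so that its
edges form a set of `n` elements; the relations keep the root and the unary vertices on the inputs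
in a member of the given family. Such a relation can occur only at the root, and it covers exactly
the prescribed set of edges. -/

namespace PTree
variable {V : Type} {ar : V → ℕ} {L M : Type}

/-! ### Vertices, edges and occurrences of tree monomials, by recursion on the tree. -/

theorem mem_vertices_node {v : V} {c : Fin (ar v) → PTree V ar L} {a : List ℕ} :
    a ∈ (node v c).vertices ↔ a = [] ∨ ∃ i : Fin (ar v), ∃ b ∈ (c i).vertices, a = i.val :: b := by
  simp [vertices, eq_comm]

theorem nil_mem_vertices {t : PTree V ar L} : [] ∈ t.vertices ↔ ¬ t.IsTrivial := by
  cases t <;> simp [vertices, IsTrivial]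

theorem mem_edges_node {v : V} {c : Fin (ar v) → PTree V ar L} {a : List ℕ} :
    a ∈ (node v c).edges ↔ ∃ i : Fin (ar v), ∃ b ∈ (c i).vertices, a = i.val :: b := by
  rw [edges, Finset.mem_erase, mem_vertices_node]
  constructor
  · rintro ⟨h, h' | h'⟩
    · exact (h h').elim
    · exact h'
  · rintro ⟨i, b, hb, rfl⟩
    exact ⟨by simp, Or.inr ⟨i, b, hb, rfl⟩⟩

theorem cons_mem_edges_node {v : V} {c : Fin (ar v) → PTree V ar L} {i : Fin (ar v)}
    {a : List ℕ} : i.val :: a ∈ (node v c).edges ↔ a ∈ (c i).vertices := by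
  rw [mem_edges_node]
  constructor
  · rintro ⟨j, b, hb, h⟩
    obtain ⟨h1, rfl⟩ := List.cons.inj h
    obtain rfl := Fin.ext h1
    exact hb
  · exact fun h => ⟨i, a, h, rfl⟩

theorem mem_vertices_iff {t : PTree V ar L} {a : List ℕ} :
    a ∈ t.vertices ↔ (a = [] ∧ ¬ t.IsTrivial) ∨ a ∈ t.edges := by
  rw [edges, Finset.mem_erase, ← nil_mem_vertices]
  by_cases h : a = []
  · subst h; simp
  · simp [h]

theorem nil_notMem_edges {t : PTree V ar L} : [] ∉ t.edges := by simp [edges]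

theorem edges_leaf (l : L) : (leaf l : PTree V ar L).edges = ∅ := rfl

theorem card_vertices (t : PTree V ar L) : t.vertices.card = t.size := by
  induction t with
  | leaf l => rfl
  | node v c ih =>
    rw [vertices, Finset.card_insert_of_notMem (by simp), size, Finset.card_biUnion, add_comm]
    · congr 1
      refine Finset.sum_congr rfl fun i _ => ?_
      rw [Finset.card_image_of_injective _ (List.cons_injective), ih]
    · intro i _ j _ hij
      refine Finset.disjoint_left.mpr ?_
      rintro a ha hb
      obtain ⟨b, -, rfl⟩ := Finset.mem_image.mp ha
      obtain ⟨b', -, h⟩ := Finset.mem_image.mp hb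
      exact hij (Fin.ext (List.cons.inj h).1.symm)

/-- Every vertex of an input is the upper end of exactly one edge of the whole tree: the root of the
input gives the edge to the new root, the others give the edges inside the input. All inductions
over edges rest on this. -/
theorem sum_edges_node {A : Type*} [AddCommMonoid A] (v : V) (c : Fin (ar v) → PTree V ar L)
    (p : List ℕ → Prop) [DecidablePred p] (f : List ℕ → A) :
    ∑ e ∈ (node v c).edges.filter p, f e =
      ∑ i, ∑ b ∈ (c i).vertices.filter (fun b => p (i.val :: b)), f (i.val :: b) := by
  have he : (PTree.node v c).edges =
      Finset.univ.biUnion fun i => (c i).vertices.image (List.cons i.val) := by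
    ext a
    rw [mem_edges_node]
    simp [eq_comm]
  rw [he, Finset.filter_biUnion, Finset.sum_biUnion]
  · refine Finset.sum_congr rfl fun i _ => ?_
    rw [Finset.filter_image, Finset.sum_image List.cons_injective.injOn]
  · intro i _ j _ hij
    refine Finset.disjoint_left.mpr ?_
    rintro a ha hb
    obtain ⟨b, -, rfl⟩ := Finset.mem_image.mp (Finset.mem_filter.mp ha).1
    obtain ⟨b', -, h⟩ := Finset.mem_image.mp (Finset.mem_filter.mp hb).1
    exact hij (Fin.ext (List.cons.inj h).1.symm)

theorem mem_vertices_of_subtreeAt {t s : PTree V ar L} {a : List ℕ}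
    (h : t.subtreeAt a = some s) {b : List ℕ} : a ++ b ∈ t.vertices ↔ b ∈ s.vertices := by
  induction t generalizing a with
  | leaf l =>
    cases a with
    | nil => simp only [subtreeAt, Option.some.injEq] at h; subst h; rfl
    | cons i a => simp [subtreeAt] at h
  | node v c ih =>
    cases a with
    | nil => simp only [subtreeAt, Option.some.injEq] at h; subst h; rfl
    | cons i a =>
      simp only [subtreeAt] at h
      split at h
      · rename_i hi
        rw [← ih ⟨i, hi⟩ h, mem_vertices_node]
        constructor
        · rintro (h | ⟨j, b', hb, h⟩)
          · simp at h
          · obtain ⟨rfl, rfl⟩ := List.cons.inj h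
            exact hb
        · exact fun hb => Or.inr ⟨⟨i, hi⟩, _, hb, rfl⟩
      · simp at h

theorem vertices_subset_graft (r : PTree V ar Unit) (f : Fin r.numLeaves → PTree V ar L) :
    r.vertices ⊆ (graft r f).vertices := by
  induction r with
  | leaf x => simp [vertices]
  | node v c ih =>
    intro a ha
    rw [graft, mem_vertices_node]
    rcases mem_vertices_node.mp ha with h | ⟨i, b, hb, rfl⟩
    · exact Or.inl h
    · exact Or.inr ⟨i, b, ih i _ hb, rfl⟩

theorem append_mem_edges_of_subtreeAt {t : PTree V ar L} {r : PTree V ar Unit}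
    {f : Fin r.numLeaves → PTree V ar L} {a b : List ℕ} (h : t.subtreeAt a = some (graft r f))
    (hb : b ∈ r.edges) : a ++ b ∈ t.edges := by
  obtain ⟨h1, h2⟩ := Finset.mem_erase.mp hb
  refine Finset.mem_erase.mpr ⟨by simp [h1], ?_⟩
  exact (mem_vertices_of_subtreeAt h).mpr (vertices_subset_graft r f h2)

theorem exists_graft_leaf {N : PTree V ar L} : ∃ f, N = graft (leaf ()) f :=
  ⟨fun _ => N, rfl⟩

/-- With `exists_graft_leaf`, this makes divisibility at the root a recursion over the inputs, so
that the numbering of leaves can be forgotten from here on. -/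
theorem exists_graft_node {v : V} {c : Fin (ar v) → PTree V ar L}
    {d : Fin (ar v) → PTree V ar Unit} :
    (∃ f, node v c = graft (node v d) f) ↔ ∀ i, ∃ f, c i = graft (d i) f := by
  constructor
  · rintro ⟨f, hf⟩ i
    exact ⟨fun p => f (finSigmaFinEquiv ⟨i, p⟩), congrFun (PTree.node.inj hf).2.eq i⟩
  · intro h
    choose f hf using h
    refine ⟨fun p => f (finSigmaFinEquiv.symm p).1 (finSigmaFinEquiv.symm p).2, ?_⟩
    rw [graft]
    congr 1; funext i; rw [hf i]
    congr 1; funext p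
    exact (congrArg (fun z : (i : Fin (ar v)) × Fin (d i).numLeaves => f z.1 z.2)
      (Equiv.symm_apply_apply finSigmaFinEquiv ⟨i, p⟩)).symm

/-- Divisibility does not see leaf labels. This is needed because a decoration is the shape of a
labelled tree. -/
theorem shape_eq_graft_iff {N : PTree V ar L} {r : PTree V ar Unit} :
    (∃ f, N.shape = graft r f) ↔ ∃ f, N = graft r f := by
  induction r generalizing N with
  | leaf x => exact ⟨fun _ => exists_graft_leaf, fun _ => exists_graft_leaf⟩
  | node v d ih =>
    cases N with
    | leaf x => simp [shape, graft]
    | node v' c =>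
      by_cases h : v' = v
      · subst h
        rw [shape, exists_graft_node, exists_graft_node]
        exact forall_congr' fun i => ih i
      · simp [shape, graft, h]

/-- The predicate also sees the address, so that the edges covered by an occurrence can be followed
through the recursion. -/
theorem exists_subtreeAt_node {v : V} {c : Fin (ar v) → PTree V ar L}
    {p : List ℕ → PTree V ar L → Prop} :
    (∃ a s, (node v c).subtreeAt a = some s ∧ p a s) ↔
      p [] (node v c) ∨ ∃ i : Fin (ar v), ∃ a s, (c i).subtreeAt a = some s ∧ p (i.val :: a) s := by
  constructor
  · rintro ⟨a, s, h, hp⟩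
    cases a with
    | nil => simp only [subtreeAt, Option.some.injEq] at h; subst h; exact Or.inl hp
    | cons i a =>
      simp only [subtreeAt] at h
      split at h
      · rename_i hi
        exact Or.inr ⟨⟨i, hi⟩, a, s, h, hp⟩
      · simp at h
  · rintro (h | ⟨i, a, s, h, hp⟩)
    · exact ⟨[], _, by simp [subtreeAt], h⟩
    · exact ⟨i.val :: a, s, by simp [subtreeAt, h], hp⟩

theorem exists_subtreeAt_leaf {l : L} {p : List ℕ → PTree V ar L → Prop} :
    (∃ a s, (leaf l : PTree V ar L).subtreeAt a = some s ∧ p a s) ↔ p [] (leaf l) := by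
  constructor
  · rintro ⟨a, s, h, hp⟩
    cases a with
    | nil => simp only [subtreeAt, Option.some.injEq] at h; subst h; exact hp
    | cons i a => simp [subtreeAt] at h
  · exact fun h => ⟨[], _, by simp [subtreeAt], h⟩

theorem exists_label_node {v : V} {c : Fin (ar v) → PTree V ar L} {p : L → Prop} :
    (∃ r, p ((node v c).label r)) ↔ ∃ i, ∃ r, p ((c i).label r) := by
  constructor
  · rintro ⟨r, hr⟩
    exact ⟨(finSigmaFinEquiv.symm r).1, (finSigmaFinEquiv.symm r).2, hr⟩
  · rintro ⟨i, r, hr⟩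
    refine ⟨finSigmaFinEquiv ⟨i, r⟩, ?_⟩
    exact (congrArg (fun z : (i : Fin (ar v)) × Fin (c i).shape.numLeaves =>
      p ((c z.1).label z.2)) (Equiv.symm_apply_apply finSigmaFinEquiv ⟨i, r⟩)).mpr hr

end PTree

/-! ### Decorated trees over `w` correspond to sets of contracted edges. -/

namespace DTree
open PTree
variable {V : Type} {ar : V → ℕ} {L : Type}

open Classical in
/-- The tree monomial `w` with the internal edges in `S` contracted: the vertices connected to the
root vertex by contracted edges are kept as a tree, whose leaves are labelled by decorated trees. -/
noncomputable def contractRoot : Set (List ℕ) → PTree V ar L → PTree V ar (DTree V ar L)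
  | _, .leaf l => .leaf (.leaf l)
  | S, .node v c => .node v fun i =>
      if [i.val] ∈ S then contractRoot {a | i.val :: a ∈ S} (c i)
      else .leaf (ofLabelled (contractRoot {a | i.val :: a ∈ S} (c i)))

/-- The decorated tree obtained from `w` by contracting the internal edges in `S`. -/
noncomputable def contract (S : Set (List ℕ)) (w : PTree V ar L) : DTree V ar L :=
  ofLabelled (contractRoot S w)

open Classical in
theorem contractRoot_node (S : Set (List ℕ)) (v : V) (c : Fin (ar v) → PTree V ar L) :
    contractRoot S (.node v c) = .node v fun i =>
      if [i.val] ∈ S then contractRoot {a | i.val :: a ∈ S} (c i)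
      else .leaf (contract {a | i.val :: a ∈ S} (c i)) := by
  rw [contractRoot]; rfl

theorem contractRoot_isTrivial {S : Set (List ℕ)} {w : PTree V ar L} :
    (contractRoot S w).IsTrivial ↔ w.IsTrivial := by
  cases w <;> simp [contractRoot, IsTrivial]

/-- Sets of arbitrary addresses are allowed as `S`, which lets the recursion pass to inputs freely;
only the actual edges matter. On an input that is a leaf both branches of the definition agree. -/
theorem contractRoot_congr {S S' : Set (List ℕ)} {w : PTree V ar L}
    (h : ∀ e ∈ w.edges, e ∈ S ↔ e ∈ S') : contractRoot S w = contractRoot S' w := by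
  classical
  induction w generalizing S S' with
  | leaf l => rw [contractRoot, contractRoot]
  | node v c ih =>
    rw [contractRoot_node, contractRoot_node]
    congr 1; funext i
    have hi : contractRoot {a | i.val :: a ∈ S} (c i) = contractRoot {a | i.val :: a ∈ S'} (c i) :=
      ih i fun e he => h _ (cons_mem_edges_node.mpr (mem_vertices_iff.mpr (Or.inr he)))
    rw [contract, contract, hi]
    cases hc : c i with
    | leaf l => simp [contractRoot, ofLabelled]
    | node v' c' =>
      have := h [i.val] (cons_mem_edges_node.mpr (nil_mem_vertices.mpr (by rw [hc]; exact fun h => h)))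
      simp only [this]

/-- On nontrivial trees `expand` undoes `ofLabelled`; the field is irrelevant. Nontriviality
matters: `leaf T` has the same image as the tree whose leaves carry the inputs of the root vertex of
`T`. -/
theorem ofLabelled_injOn {N N' : PTree V ar (DTree V ar L)} (h : ¬ N.IsTrivial)
    (h' : ¬ N'.IsTrivial) (e : ofLabelled N = ofLabelled N') : N = N' := by
  have h1 := expand_ofLabelled ℚ h
  rw [e, expand_ofLabelled ℚ h'] at h1
  exact (Finsupp.single_left_injective one_ne_zero h1).symm

/-- A nontrivial input of `w` becomes a leaf of the root piece exactly when the edge below it is not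
contracted. The root piece thus reveals this edge, and the rest of `S` is recovered inside the
inputs. -/
theorem contractRoot_inj {S S' : Set (List ℕ)} {w : PTree V ar L}
    (h : contractRoot S w = contractRoot S' w) : ∀ e ∈ w.edges, e ∈ S ↔ e ∈ S' := by
  classical
  induction w generalizing S S' with
  | leaf l => simp [edges_leaf]
  | node v c ih =>
    intro e he
    obtain ⟨i, b, hb, rfl⟩ := mem_edges_node.mp he
    rw [contractRoot_node, contractRoot_node] at h
    have hi := congrFun (PTree.node.inj h).2.eq i
    have ht : ¬ (c i).IsTrivial := by
      intro ht
      cases hc : c i with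
      | leaf l => rw [hc] at hb; simp [vertices] at hb
      | node v' c' => rw [hc] at ht; exact ht
    have key : ([i.val] ∈ S ↔ [i.val] ∈ S') ∧
        contractRoot {a | i.val :: a ∈ S} (c i) = contractRoot {a | i.val :: a ∈ S'} (c i) := by
      by_cases h1 : [i.val] ∈ S <;> by_cases h2 : [i.val] ∈ S' <;> simp only [h1, h2, if_true, if_false] at hi ⊢
      · exact ⟨trivial, hi⟩
      · exact (ht (contractRoot_isTrivial.mp (by rw [hi]; trivial))).elim
      · exact (ht (contractRoot_isTrivial.mp (by rw [← hi]; trivial))).elim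
      · refine ⟨trivial, ofLabelled_injOn ?_ ?_ (PTree.leaf.inj hi)⟩ <;>
          rwa [contractRoot_isTrivial]
    rcases mem_vertices_iff.mp hb with ⟨rfl, -⟩ | hb
    · exact key.1
    · exact ih i key.2 b hb

theorem contract_inj {S S' : Set (List ℕ)} {w : PTree V ar L}
    (h : contract S w = contract S' w) : ∀ e ∈ w.edges, e ∈ S ↔ e ∈ S' := by
  by_cases hw : w.IsTrivial
  · cases w with
    | leaf l => simp [edges_leaf]
    | node v c => exact hw.elim
  · exact contractRoot_inj (ofLabelled_injOn (by rwa [contractRoot_isTrivial])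
      (by rwa [contractRoot_isTrivial]) h)

theorem bind_contractRoot (S : Set (List ℕ)) (w : PTree V ar L) :
    (contractRoot S w).bind flatten = w := by
  classical
  induction w generalizing S with
  | leaf l => rw [contractRoot]; rfl
  | node v c ih =>
    rw [contractRoot_node, PTree.bind]
    congr 1; funext i
    split_ifs
    · exact ih i _
    · rw [PTree.bind, contract, flatten_ofLabelled, ih]

theorem flatten_contract (S : Set (List ℕ)) (w : PTree V ar L) : flatten (contract S w) = w := by
  rw [contract, flatten_ofLabelled, bind_contractRoot]

/-- The labelled tree `N` arises from its total composition by contracting the edges in `S`. -/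
def IsContraction (S : Set (List ℕ)) : PTree V ar (DTree V ar L) → Prop
  | .leaf T => contract S (flatten T) = T
  | .node v c => contractRoot S ((PTree.node v c).bind flatten) = .node v c

/-- The inductive step for surjectivity: sets of contracted edges found for the inputs are glued
along the new root vertex. -/
theorem exists_isContraction_node {v : V} {c : Fin (ar v) → PTree V ar (DTree V ar L)}
    (h : ∀ i, ∃ S, IsContraction S (c i)) : ∃ S, IsContraction S (.node v c) := by
  classical
  choose S hS using h
  -- The empty address stands for the edge from the root to input `i`. It is contracted precisely if
  -- that input still belongs to the root piece, i.e. is not a leaf of it.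
  refine ⟨{x | ∃ i : Fin (ar v), ∃ a, x = i.val :: a ∧ if a = [] then ¬ (c i).IsTrivial else a ∈ S i}, ?_⟩
  rw [IsContraction, PTree.bind, contractRoot_node]
  congr 1; funext i
  have hm : ∀ a, (i.val :: a ∈ {x | ∃ i : Fin (ar v), ∃ a, x = i.val :: a ∧
      if a = [] then ¬ (c i).IsTrivial else a ∈ S i}) ↔
      if a = [] then ¬ (c i).IsTrivial else a ∈ S i := by
    intro a
    constructor
    · rintro ⟨j, b, h, hb⟩
      obtain ⟨h1, rfl⟩ := List.cons.inj h
      obtain rfl := Fin.ext h1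
      exact hb
    · exact fun h => ⟨i, a, rfl, h⟩
  have hr : contractRoot {a | i.val :: a ∈ {x | ∃ i : Fin (ar v), ∃ a, x = i.val :: a ∧
      if a = [] then ¬ (c i).IsTrivial else a ∈ S i}} ((c i).bind flatten) =
      contractRoot (S i) ((c i).bind flatten) := by
    refine contractRoot_congr fun e he => ?_
    have : e ≠ [] := fun h => nil_notMem_edges (h ▸ he)
    rw [Set.mem_ofPred_eq, hm, if_neg this]
  rw [contract, hr]
  simp only [hm, if_true]
  have hi := hS i
  cases hc : c i with
  | leaf T =>
    rw [hc] at hi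
    rw [if_neg (by simp [IsTrivial])]
    exact congrArg PTree.leaf hi
  | node v' c' =>
    rw [hc] at hi
    rw [if_pos (by simp [IsTrivial])]
    exact hi

theorem exists_isContraction_graft (m : PTree V ar Unit)
    (g : Fin m.numLeaves → PTree V ar (DTree V ar L)) (h : ∀ p, ∃ S, IsContraction S (g p)) :
    ∃ S, IsContraction S (graft m g) := by
  induction m with
  | leaf x => exact h (0 : Fin 1)
  | node v d ih => exact exists_isContraction_node fun i => ih i _ fun p => h _

theorem exists_contract_flatten (T : DTree V ar L) : ∃ S, contract S (flatten T) = T := by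
  induction T with
  | leaf l => exact ⟨∅, by rw [flatten, contract, contractRoot, ofLabelled]⟩
  | node m c ih =>
    obtain ⟨S, hS⟩ := exists_isContraction_graft m.1 (fun p => .leaf (c p)) ih
    refine ⟨S, ?_⟩
    have hm := graft_not_trivial m.2 (fun p => PTree.leaf (V := V) (ar := ar) (c p))
    rw [← ofLabelled_graft_leaf, flatten_ofLabelled]
    cases hg : graft m.1 (fun p => PTree.leaf (V := V) (ar := ar) (c p)) with
    | leaf => rw [hg] at hm; exact (hm trivial).elim
    | node v d => rw [hg] at hS; rw [contract, hS]

-- The vertices counted by `weight` are those outside the root piece, and each sits on top of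
-- exactly one uncontracted edge.
open Classical in
theorem weight_contractRoot (S : Set (List ℕ)) (w : PTree V ar L) :
    weight (contractRoot S w) = (w.edges.filter (· ∉ S)).card := by
  induction w generalizing S with
  | leaf l => rw [contractRoot]; rfl
  | node v c ih =>
    rw [contractRoot_node, weight, Finset.card_eq_sum_ones, sum_edges_node]
    refine Finset.sum_congr rfl fun i _ => ?_
    rw [← Finset.card_eq_sum_ones]
    -- The edges inside the input are its vertices except its root, and the root stands for the edge
    -- `[i]`. That edge is filtered out if it is contracted; otherwise it accounts for the
    -- additional vertex of the label.
    have h1 : (c i).edges.filter (fun a => i.val :: a ∉ S) =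
        ((c i).vertices.filter (fun a => i.val :: a ∉ S)).erase [] := by
      rw [edges, Finset.filter_erase]
    split_ifs with hi
    · rw [ih]
      refine (congrArg Finset.card h1).trans ?_
      rw [Finset.erase_eq_of_notMem (by simp [hi])]
    · rw [weight]
      by_cases ht : (c i).IsTrivial
      · cases hc : c i with
        | leaf l => rw [contract, contractRoot]; rfl
        | node v' c' => rw [hc] at ht; exact ht.elim
      · rw [contract, size_ofLabelled (by rwa [contractRoot_isTrivial]), ih, add_comm]
        refine (congrArg (fun s => s.card + 1) h1).trans ?_
        exact Finset.card_erase_add_one (by simp [hi, nil_mem_vertices, ht])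

open Classical in
theorem size_contract_add_card (S : Set (List ℕ)) (w : PTree V ar L) :
    (contract S w).size + (w.edges.filter (· ∈ S)).card = w.size := by
  by_cases ht : w.IsTrivial
  · cases w with
    | leaf l => rw [contract, contractRoot]; rfl
    | node v c => exact ht.elim
  · have h1 : w.edges.card + 1 = w.size := by
      rw [← card_vertices]
      exact Finset.card_erase_add_one (nil_mem_vertices.mpr ht)
    have h2 := Finset.card_filter_add_card_filter_not (s := w.edges) (· ∈ S)
    rw [contract, size_ofLabelled (by rwa [contractRoot_isTrivial]), weight_contractRoot]
    omega

/-! ### Vanishing of a contraction in the operad. -/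

/-- One of the decorations of `ofLabelled N` lies in the ideal generated by `R`. -/
def LabelledVanishes (R : Set (PTree V ar Unit)) (N : PTree V ar (DTree V ar L)) : Prop :=
  InIdeal R N.shape ∨ ∃ p, Vanishes R (N.label p)

theorem inIdeal_iff {R : Set (PTree V ar Unit)} {t : PTree V ar Unit} :
    InIdeal R t ↔ ∃ a s, t.subtreeAt a = some s ∧ ∃ r ∈ R, ∃ f, s = graft r f := by
  constructor
  · rintro ⟨r, hr, a, f, h⟩
    exact ⟨a, _, h, r, hr, f, rfl⟩
  · rintro ⟨a, s, h, r, hr, f, rfl⟩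
    exact ⟨r, hr, a, f, h⟩

/-- For a single leaf the shape is the trivial tree, which is outside the ideal only because no
relation is trivial. -/
theorem vanishes_ofLabelled {R : Set (PTree V ar Unit)} {N : PTree V ar (DTree V ar L)}
    (hR : ∀ r ∈ R, ¬ r.IsTrivial) : Vanishes R (ofLabelled N) ↔ LabelledVanishes R N := by
  cases N with
  | node v c => exact Iff.rfl
  | leaf T =>
    rw [LabelledVanishes, or_iff_right]
    · exact ⟨fun h => ⟨(0 : Fin 1), h⟩, fun ⟨_, h⟩ => h⟩
    · rw [inIdeal_iff, shape, exists_subtreeAt_leaf]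
      rintro ⟨r, hr, f, h⟩
      have := graft_not_trivial (hR r hr) f
      rw [← h] at this
      exact this trivial

theorem labelledVanishes_leaf {R : Set (PTree V ar Unit)} {T : DTree V ar L}
    (hR : ∀ r ∈ R, ¬ r.IsTrivial) : LabelledVanishes R (.leaf T) ↔ Vanishes R T :=
  (vanishes_ofLabelled (N := .leaf T) hR).symm

/-- The root piece and its labels are treated together, so occurrences in any decoration obey one
recursion, whether or not an edge has been cut. -/
theorem labelledVanishes_node {R : Set (PTree V ar Unit)} {v : V}
    {c : Fin (ar v) → PTree V ar (DTree V ar L)} :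
    LabelledVanishes R (.node v c) ↔
      (∃ r ∈ R, ∃ f, PTree.node v c = graft r f) ∨ ∃ i, LabelledVanishes R (c i) := by
  rw [LabelledVanishes, exists_label_node (p := Vanishes R), inIdeal_iff, shape,
    exists_subtreeAt_node (p := fun _ s => ∃ r ∈ R, ∃ f, s = graft r f)]
  have h1 : (∃ r ∈ R, ∃ f, (PTree.node v fun i => (c i).shape) = graft r f) ↔
      ∃ r ∈ R, ∃ f, PTree.node v c = graft r f :=
    exists_congr fun r => and_congr_right fun _ => shape_eq_graft_iff (N := .node v c)
  rw [h1, or_assoc, ← exists_or]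
  simp only [LabelledVanishes, inIdeal_iff]

/-- Some monomial of `R` occurs in `w` with all its internal edges in `S`. -/
def OccursWithin (R : Set (PTree V ar Unit)) (S : Set (List ℕ)) (w : PTree V ar L) : Prop :=
  ∃ a s, w.subtreeAt a = some s ∧ ∃ r ∈ R, (∃ f, s = graft r f) ∧ ∀ b ∈ r.edges, a ++ b ∈ S

/-- The root piece is the part of `w` reachable from the root through contracted edges. Where an
edge is cut it ends in a leaf, and no nontrivial part of `r` fits there. -/
theorem contractRoot_eq_graft_iff {r : PTree V ar Unit} {S : Set (List ℕ)} {w : PTree V ar L} :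
    (∃ f, contractRoot S w = graft r f) ↔ (∃ f, w = graft r f) ∧ ∀ b ∈ r.edges, b ∈ S := by
  classical
  induction r generalizing S w with
  | leaf x =>
    exact iff_of_true exists_graft_leaf ⟨exists_graft_leaf, by simp [edges_leaf]⟩
  | node v d ih =>
    cases w with
    | leaf l => simp [contractRoot, graft]
    | node v' c =>
      by_cases hv : v' = v
      swap
      · simp [contractRoot, graft, hv]
      subst hv
      rw [contractRoot_node, exists_graft_node, exists_graft_node]
      have he : (∀ b ∈ (PTree.node v' d).edges, b ∈ S) ↔
          ∀ i, (¬ (d i).IsTrivial → [i.val] ∈ S) ∧ ∀ b ∈ (d i).edges, i.val :: b ∈ S := by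
        constructor
        · intro h i
          exact ⟨fun hi => h _ (cons_mem_edges_node.mpr (nil_mem_vertices.mpr hi)),
            fun b hb => h _ (cons_mem_edges_node.mpr (mem_vertices_iff.mpr (Or.inr hb)))⟩
        · intro h b hb
          obtain ⟨i, b, hb', rfl⟩ := mem_edges_node.mp hb
          rcases mem_vertices_iff.mp hb' with ⟨rfl, hi⟩ | hb'
          · exact (h i).1 hi
          · exact (h i).2 b hb'
      rw [he, ← forall_and]
      refine forall_congr' fun i => ?_
      by_cases ht : (d i).IsTrivial
      · cases hd : d i with
        | node v' c' => rw [hd] at ht; exact ht.elim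
        | leaf x =>
          exact iff_of_true exists_graft_leaf
            ⟨exists_graft_leaf, fun h => (h trivial).elim, by simp [edges_leaf]⟩
      · simp only [ht, not_false_eq_true, true_imp_iff]
        split_ifs with hi
        · rw [ih i]
          simp [hi]
        · simp only [hi, false_and, and_false, iff_false, not_exists]
          intro f hf
          refine graft_not_trivial ht f ?_
          rw [← hf]; trivial

theorem labelledVanishes_contractRoot {R : Set (PTree V ar Unit)} {S : Set (List ℕ)}
    {w : PTree V ar L} (hR : ∀ r ∈ R, ¬ r.IsTrivial) :
    LabelledVanishes R (contractRoot S w) ↔ OccursWithin R S w := by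
  classical
  induction w generalizing S with
  | leaf l =>
    rw [contractRoot, labelledVanishes_leaf hR, OccursWithin,
      exists_subtreeAt_leaf (p := fun a s =>
        ∃ r ∈ R, (∃ f, s = graft r f) ∧ ∀ b ∈ r.edges, a ++ b ∈ S)]
    refine iff_of_false (fun h => h) ?_
    rintro ⟨r, hr, ⟨f, h⟩, -⟩
    have := graft_not_trivial (hR r hr) f
    rw [← h] at this
    exact this trivial
  | node v c ih =>
    have h1 := fun r => contractRoot_eq_graft_iff (r := r) (S := S) (w := .node v c)
    rw [contractRoot_node] at h1 ⊢
    rw [labelledVanishes_node, OccursWithin,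
      exists_subtreeAt_node (p := fun a s =>
        ∃ r ∈ R, (∃ f, s = graft r f) ∧ ∀ b ∈ r.edges, a ++ b ∈ S)]
    refine or_congr (exists_congr fun r => and_congr_right fun _ => h1 r)
      (exists_congr fun i => ?_)
    refine Iff.trans ?_ (ih i (S := {a | i.val :: a ∈ S}))
    split_ifs
    · rfl
    · rw [labelledVanishes_leaf hR, contract, vanishes_ofLabelled hR]

theorem vanishes_contract {R : Set (PTree V ar Unit)} {S : Set (List ℕ)} {w : PTree V ar L}
    (hR : ∀ r ∈ R, ¬ r.IsTrivial) : Vanishes R (contract S w) ↔ OccursWithin R S w := by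
  rw [contract, vanishes_ofLabelled hR, labelledVanishes_contractRoot hR]

/-! ### The bar differential of a contraction. -/

open Classical in
theorem barDiff_contract_of_labDiff {k : Type*} [Field k] {S : Set (List ℕ)} {w : PTree V ar L}
    {u : List ℕ → k} (h : labDiff k (contractRoot S w) =
      ∑ e ∈ w.edges.filter (· ∉ S), u e • Finsupp.single (contractRoot (insert e S) w) 1) :
    barDiff k (contract S w) =
      ∑ e ∈ w.edges.filter (· ∉ S), u e • Finsupp.single (contract (insert e S) w) 1 := by
  by_cases ht : w.IsTrivial
  · cases w with
    | leaf l => rw [contract, contractRoot]; rfl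
    | node v c => exact ht.elim
  · rw [contract, barDiff_ofLabelled k (by rwa [contractRoot_isTrivial]), h,
      Finsupp.mapDomain_finsetSum]
    refine Finset.sum_congr rfl fun e _ => ?_
    rw [Finsupp.mapDomain_smul, Finsupp.mapDomain_single]
    rfl

-- Merging two adjacent pieces means contracting the one edge of `w` between them. Only the
-- nonvanishing of the coefficients is recorded; the signs are dealt with by rescaling.
open Classical in
theorem labDiff_contractRoot (k : Type*) [Field k] (S : Set (List ℕ)) (w : PTree V ar L) :
    ∃ u : List ℕ → k, (∀ e, u e ≠ 0) ∧ labDiff k (contractRoot S w) =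
      ∑ e ∈ w.edges.filter (· ∉ S), u e • Finsupp.single (contractRoot (insert e S) w) 1 := by
  induction w generalizing S with
  | leaf l =>
    refine ⟨fun _ => 1, fun _ => one_ne_zero, ?_⟩
    rw [contractRoot]
    simp [labDiff, expand, barDiff, edges_leaf]
  | node v c ih =>
    have hsub : ∀ (i : Fin (ar v)) (b : List ℕ),
        {a | i.val :: a ∈ insert (i.val :: b) S} = insert b {a | i.val :: a ∈ S} := by
      intro i b; ext a; simp
    have hsub' : ∀ (i j : Fin (ar v)) (b : List ℕ), j ≠ i →
        ∀ a, j.val :: a ∈ insert (i.val :: b) S ↔ j.val :: a ∈ S := by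
      intro i j b hij a
      simp [Fin.val_ne_of_ne hij]
    set child : Set (List ℕ) → Fin (ar v) → PTree V ar (DTree V ar L) := fun S i =>
      if [i.val] ∈ S then contractRoot {a | i.val :: a ∈ S} (c i)
      else .leaf (contract {a | i.val :: a ∈ S} (c i)) with hchild
    have key : ∀ i, ∃ u : List ℕ → k, (∀ b, u b ≠ 0) ∧ labDiff k (child S i) =
        ∑ b ∈ (c i).vertices.filter (fun b => i.val :: b ∉ S),
          u b • Finsupp.single (child (insert (i.val :: b) S) i) 1 := by
      intro i
      obtain ⟨u, hu, h⟩ := ih i {a | i.val :: a ∈ S}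
      have h1 : (c i).edges.filter (fun a => i.val :: a ∉ S) =
          ((c i).vertices.filter (fun a => i.val :: a ∉ S)).erase [] := by
        rw [edges, Finset.filter_erase]
      by_cases hi : [i.val] ∈ S
      · refine ⟨u, hu, ?_⟩
        simp only [hchild, if_pos hi, if_pos (Set.mem_insert_of_mem _ hi), hsub]
        rw [h]
        refine Finset.sum_congr (h1.trans (Finset.erase_eq_of_notMem (by simp [hi]))) fun b _ => rfl
      · by_cases ht : (c i).IsTrivial
        · refine ⟨u, hu, ?_⟩
          simp only [hchild, if_neg hi]
          cases hc : c i with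
          | node v' c' => rw [hc] at ht; exact ht.elim
          | leaf l =>
            rw [contract, contractRoot, ofLabelled, labDiff]
            simp [vertices, barDiff, expand]
        -- Here `[i]` is not contracted. The empty address, standing for `[i]` itself, gives the
        -- `expand` term of `labDiff`; the edges inside the input come from the differential of the
        -- label, which enters with a minus sign.
        · refine ⟨fun b => if b = [] then 1 else -u b, fun b => ?_, ?_⟩
          · dsimp only
            split_ifs
            · exact one_ne_zero
            · exact neg_ne_zero.mpr (hu b)
          have h2 : [] ∈ (c i).vertices.filter (fun b => i.val :: b ∉ S) := by
            simp [hi, nil_mem_vertices, ht]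
          rw [← Finset.add_sum_erase _ _ h2]
          simp only [hchild, if_neg hi, hsub]
          rw [labDiff, contract, expand_ofLabelled k (by rwa [contractRoot_isTrivial]), ← contract,
            barDiff_contract_of_labDiff h, Finsupp.mapDomain_finsetSum, sub_eq_add_neg]
          congr 1
          · rw [if_pos trivial, one_smul, if_pos (Set.mem_insert _ _)]
            congr 1
            -- Adding `[i]` to `S` adds only the empty address to the set seen by the input, and
            -- this is not an edge of the input.
            refine contractRoot_congr fun e he => ?_
            have : e ≠ [] := fun h => nil_notMem_edges (h ▸ he)
            simp [this]
          · rw [← Finset.sum_neg_distrib]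
            refine Finset.sum_congr h1 fun b hb => ?_
            have hb' := (Finset.mem_erase.mp hb).1
            rw [Finsupp.mapDomain_smul, Finsupp.mapDomain_single, if_neg hb', neg_smul,
              if_neg (by simp [hi, Ne.symm hb'])]
    choose u hu h using key
    -- The Koszul sign of the earlier inputs times the coefficient found in input `i`. The value 1
    -- at addresses that do not lead into an input only keeps `u` nowhere zero.
    refine ⟨fun e => match e with
      | [] => 1
      | i :: b => if hi : i < ar v then
          (-1 : k) ^ (∑ q ∈ Finset.Iio (⟨i, hi⟩ : Fin (ar v)), weight (child S q)) * u ⟨i, hi⟩ b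
          else 1, ?_, ?_⟩
    · rintro (_ | ⟨i, b⟩)
      · exact one_ne_zero
      · dsimp only
        split_ifs with hi
        · exact mul_ne_zero (pow_ne_zero _ (neg_ne_zero.mpr one_ne_zero)) (hu _ _)
        · exact one_ne_zero
    · rw [sum_edges_node, contractRoot_node]
      change labDiff k (.node v (child S)) = _
      rw [labDiff]
      refine Finset.sum_congr rfl fun i _ => ?_
      rw [h i, Finsupp.mapDomain_finsetSum, Finset.smul_sum]
      refine Finset.sum_congr rfl fun b _ => ?_
      rw [Finsupp.mapDomain_smul, Finsupp.mapDomain_single, smul_smul]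
      simp only [i.2, dite_true]
      congr 2
      rw [contractRoot_node]
      congr 1; funext j
      by_cases hj : j = i
      · subst hj; rw [Function.update_self]
      · rw [Function.update_of_ne hj]
        have hs := hsub' i j b hj
        simp only [hchild, hs]

open Classical in
theorem barDiff_contract (k : Type*) [Field k] (S : Set (List ℕ)) (w : PTree V ar L) :
    ∃ u : List ℕ → k, (∀ e, u e ≠ 0) ∧ barDiff k (contract S w) =
      ∑ e ∈ w.edges.filter (· ∉ S), u e • Finsupp.single (contract (insert e S) w) 1 := by
  obtain ⟨u, hu, h⟩ := labDiff_contractRoot k S w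
  exact ⟨u, hu, barDiff_contract_of_labDiff h⟩

end DTree

/-! ### Rescaling the vertices of a cube. -/

/-- Two nowhere vanishing functions on the edges of a cube whose differentials both square to zero
differ by a rescaling of the vertices. Here `r` is the quotient of the two functions. -/
theorem exists_rescaling {k ι : Type*} [Field k] [Fintype ι] [DecidableEq ι] (r : Finset ι → ι → k)
    (hr : ∀ S i, r S i ≠ 0)
    (hcomm : ∀ S i j, i ∉ S → j ∉ S → i ≠ j →
      r S i * r (insert i S) j = r S j * r (insert j S) i) :
    ∃ ε : Finset ι → k, (∀ S, ε S ≠ 0) ∧ ∀ S i, i ∉ S → ε (insert i S) = ε S * r S i := by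
  -- Induction on the dimension of the face of subsets of `U`.
  have key : ∀ U : Finset ι, ∃ ε : Finset ι → k, (∀ S, ε S ≠ 0) ∧
      ∀ S i, i ∉ S → insert i S ⊆ U → ε (insert i S) = ε S * r S i := by
    intro U
    induction U using Finset.induction_on with
    | empty =>
      refine ⟨fun _ => 1, fun _ => one_ne_zero, fun S i _ h => ?_⟩
      exact absurd (h (Finset.mem_insert_self i S)) (Finset.notMem_empty i)
    | insert m U hm ih =>
      obtain ⟨ε, h0, h⟩ := ih
      -- The opposite face is reached by the edges in direction `m`, which forces the values there.
      -- The edges within that face then fit because `r` commutes around the squares containing the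
      -- direction `m`.
      refine ⟨fun S => if m ∈ S then ε (S.erase m) * r (S.erase m) m else ε S, fun S => ?_,
        fun S i hi hU => ?_⟩
      · dsimp only
        split_ifs
        · exact mul_ne_zero (h0 _) (hr _ _)
        · exact h0 _
      · dsimp only
        have hU' : ∀ x ∈ insert i S, x ≠ m → x ∈ U := fun x hx hxm =>
          (Finset.mem_insert.mp (hU hx)).resolve_left hxm
        by_cases him : i = m
        · subst him
          rw [if_pos (Finset.mem_insert_self _ _), if_neg hi, Finset.erase_insert hi]
        · by_cases hmS : m ∈ S
          · rw [if_pos (Finset.mem_insert_of_mem hmS), if_pos hmS,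
              Finset.erase_insert_of_ne him]
            have hi' : i ∉ S.erase m := fun h => hi (Finset.mem_of_mem_erase h)
            rw [h _ i hi', mul_assoc, mul_assoc,
              hcomm _ i m hi' (Finset.notMem_erase m S) him, Finset.insert_erase hmS]
            intro x hx
            rcases Finset.mem_insert.mp hx with rfl | hx
            · exact hU' _ (Finset.mem_insert_self _ _) him
            · exact hU' _ (Finset.mem_insert_of_mem (Finset.mem_of_mem_erase hx))
                (Finset.ne_of_mem_erase hx)
          · have hmS' : m ∉ insert i S := by simp [hmS, Ne.symm him]
            rw [if_neg hmS', if_neg hmS, h S i hi]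
            exact fun x hx => hU' x hx fun h => hmS' (h ▸ hx)
  obtain ⟨ε, h0, h⟩ := key Finset.univ
  exact ⟨ε, h0, fun S i hi => h S i hi (Finset.subset_univ _)⟩

/-! ### The monomial basis of the Grassmann algebra and its monomial ideals. -/

namespace Grassmann
open ExteriorAlgebra

variable (k : Type*) [Field k] (ι : Type) [LinearOrder ι]

/-- The basis of the Grassmann algebra formed by the increasing products of the variables. -/
noncomputable abbrev basis : Module.Basis (Finset ι) k (ExteriorAlgebra k (ι →₀ k)) :=
  (Finsupp.basisSingleOne (R := k) (ι := ι)).ExteriorAlgebra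

variable {ι}

theorem basis_singleton (i : ι) : basis k ι {i} = gen k ι i := by
  rw [basis, basis_apply_ofCard (n := 1) _ (Finset.card_singleton i), ιMulti_family]
  simp [ιMulti_apply, Set.powersetCard.ofFinEmbEquiv, gen]

theorem basis_empty : basis k ι ∅ = 1 := by
  rw [basis, basis_apply_ofCard (n := 0) _ Finset.card_empty, ιMulti_family]
  simp [ιMulti_apply]

theorem exists_basis_mul {S T : Finset ι} (h : Disjoint S T) :
    ∃ u : k, u ≠ 0 ∧ basis k ι S * basis k ι T = u • basis k ι (S ∪ T) := by
  have h' : Disjoint (Set.powersetCard.ofCard (s := S) rfl).val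
    (Set.powersetCard.ofCard (s := T) rfl).val := h
  refine ⟨((Set.powersetCard.permOfDisjoint h').sign : ℤ), ?_, ?_⟩
  · rcases Int.units_eq_one_or (Set.powersetCard.permOfDisjoint h').sign with e | e <;> simp [e]
  · refine (basis_mul_of_disjoint _ _ _ h').trans ?_
    rw [Int.cast_smul_eq_zsmul]
    change _ • basis k ι (S.disjUnion T h) = _
    rw [Finset.disjUnion_eq_union]
    rfl

theorem basis_mul_eq_zero {S T : Finset ι} (h : ¬ Disjoint S T) :
    basis k ι S * basis k ι T = 0 :=
  basis_mul_of_not_disjoint _ (Set.powersetCard.ofCard (s := S) rfl)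
    (Set.powersetCard.ofCard (s := T) rfl) h

/-- The list enumerating `S` has an arbitrary order, hence the unspecified unit. -/
theorem exists_monomial_eq (S : Finset ι) :
    ∃ u : k, u ≠ 0 ∧ monomial k ι S = u • basis k ι S := by
  have key : ∀ l : List ι, l.Nodup →
      ∃ u : k, u ≠ 0 ∧ (l.map (gen k ι)).prod = u • basis k ι l.toFinset := by
    intro l hl
    induction l with
    | nil => exact ⟨1, one_ne_zero, by simp [basis_empty]⟩
    | cons i l ih =>
      obtain ⟨hi, hl⟩ := List.nodup_cons.mp hl
      obtain ⟨u, hu, h⟩ := ih hl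
      obtain ⟨u', hu', h'⟩ := exists_basis_mul k (S := {i}) (T := l.toFinset) (by simpa using hi)
      refine ⟨u * u', mul_ne_zero hu hu', ?_⟩
      rw [List.map_cons, List.prod_cons, h, ← basis_singleton, mul_smul_comm, h', smul_smul,
        List.toFinset_cons]
      rfl
  obtain ⟨u, hu, h⟩ := key S.toList S.nodup_toList
  exact ⟨u, hu, by rw [monomial, h, Finset.toList_toFinset]⟩

theorem exteriorPower_eq_span (j : ℕ) :
    ⋀[k]^j (ι →₀ k) = Submodule.span k (basis k ι '' {S | S.card = j}) := by
  have h := congrArg (Submodule.map (⋀[k]^j (ι →₀ k)).subtype)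
    ((Finsupp.basisSingleOne (R := k) (ι := ι)).exteriorPower j).span_eq
  rw [Submodule.map_subtype_top, Submodule.map_span, ← Set.range_comp] at h
  rw [← h]
  congr 1
  ext x
  constructor
  · rintro ⟨s, rfl⟩
    exact ⟨s.1, s.2, basis_eq_coe_basis _ s⟩
  · rintro ⟨S, hS, rfl⟩
    exact ⟨⟨S, hS⟩, (basis_eq_coe_basis _ _).symm⟩

/-- A product of basis elements is zero or a unit multiple of the basis element of the union, so
this span absorbs multiplication on both sides. Conversely, if `A ⊆ S`, the basis element of `S` is
a unit multiple of the monomial of `A` times that of `S \ A`. -/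
theorem mem_monomialIdeal_iff {R : Set (Finset ι)} {x : ExteriorAlgebra k (ι →₀ k)} :
    x ∈ monomialIdeal k ι R ↔
      x ∈ Submodule.span k (basis k ι '' {S | ∃ A ∈ R, A ⊆ S}) := by
  set K : Set (Finset ι) := {S | ∃ A ∈ R, A ⊆ S} with hK
  have htop : ∀ a, a ∈ Submodule.span k (Set.range (basis k ι)) := fun a => by
    rw [(basis k ι).span_eq]; trivial
  have hmul : ∀ S T, (S ∈ K ∨ T ∈ K) →
      basis k ι S * basis k ι T ∈ Submodule.span k (basis k ι '' K) := by
    intro S T h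
    by_cases hd : Disjoint S T
    · obtain ⟨u, -, hu⟩ := exists_basis_mul k hd
      rw [hu]
      refine Submodule.smul_mem _ _ (Submodule.subset_span ⟨_, ?_, rfl⟩)
      rcases h with ⟨A, hA, h⟩ | ⟨A, hA, h⟩
      · exact ⟨A, hA, h.trans Finset.subset_union_left⟩
      · exact ⟨A, hA, h.trans Finset.subset_union_right⟩
    · rw [basis_mul_eq_zero k hd]
      exact Submodule.zero_mem _
  rw [monomialIdeal, TwoSidedIdeal.mem_asIdeal]
  constructor
  · intro hx
    induction hx using TwoSidedIdeal.span_induction with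
    | mem x h =>
      obtain ⟨A, hA, rfl⟩ := h
      obtain ⟨u, -, hu⟩ := exists_monomial_eq k A
      rw [hu]
      exact Submodule.smul_mem _ _ (Submodule.subset_span ⟨A, ⟨A, hA, subset_rfl⟩, rfl⟩)
    | zero => exact Submodule.zero_mem _
    | add x y _ _ hx hy => exact Submodule.add_mem _ hx hy
    | neg x _ hx => exact Submodule.neg_mem _ hx
    | left_absorb a x _ hx =>
      have h := Submodule.mul_mem_mul (htop a) hx
      rw [Submodule.span_mul_span] at h
      refine Submodule.span_le.mpr ?_ h
      rintro _ ⟨_, ⟨S, rfl⟩, _, ⟨T, hT, rfl⟩, rfl⟩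
      exact hmul S T (Or.inr hT)
    | right_absorb a x _ hx =>
      have h := Submodule.mul_mem_mul hx (htop a)
      rw [Submodule.span_mul_span] at h
      refine Submodule.span_le.mpr ?_ h
      rintro _ ⟨_, ⟨S, hS, rfl⟩, _, ⟨T, rfl⟩, rfl⟩
      exact hmul S T (Or.inl hS)
  · intro hx
    induction hx using Submodule.span_induction with
    | zero => exact zero_mem _
    | add x y _ _ hx hy => exact add_mem hx hy
    | smul a x _ hx =>
      rw [Algebra.smul_def]
      exact TwoSidedIdeal.mul_mem_left _ _ _ hx
    | mem x h =>
      obtain ⟨S, ⟨A, hA, hAS⟩, rfl⟩ := h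
      obtain ⟨u, hu, h⟩ := exists_monomial_eq k A
      obtain ⟨u', hu', h'⟩ := exists_basis_mul k (Finset.disjoint_sdiff (s := A) (t := S))
      rw [Finset.union_sdiff_of_subset hAS] at h'
      have e : basis k ι S = algebraMap k _ (u * u')⁻¹ * (monomial k ι A * basis k ι (S \ A)) := by
        rw [h, smul_mul_assoc, h', ← Algebra.smul_def, smul_smul, smul_smul,
          mul_assoc, inv_mul_cancel₀ (mul_ne_zero hu hu'), one_smul]
      rw [e]
      exact TwoSidedIdeal.mul_mem_left _ _ _ (TwoSidedIdeal.mul_mem_right _ _ _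
        (TwoSidedIdeal.subset_span ⟨A, hA, rfl⟩))

variable (ι) in
theorem exists_basis_mul_sum_gen [Fintype ι] :
    ∃ g : Finset ι → ι → k, (∀ S i, g S i ≠ 0) ∧
      (∀ S, basis k ι S * ∑ i, gen k ι i = ∑ i ∈ Sᶜ, g S i • basis k ι (insert i S)) := by
  have h : ∀ (S : Finset ι) (i : ι), ∃ u : k, u ≠ 0 ∧
      (i ∉ S → basis k ι S * gen k ι i = u • basis k ι (insert i S)) := by
    intro S i
    by_cases hi : i ∈ S
    -- This product vanishes; the value 1 is a dummy making `g` nowhere zero.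
    · exact ⟨1, one_ne_zero, fun h => (h hi).elim⟩
    · obtain ⟨u, hu, h⟩ := exists_basis_mul k (Finset.disjoint_singleton_right.mpr hi)
      refine ⟨u, hu, fun _ => ?_⟩
      rw [← basis_singleton, h, Finset.union_comm]
      rfl
  choose g hg h using h
  refine ⟨g, hg, fun S => ?_⟩
  rw [Finset.mul_sum, ← Finset.sum_subset (Finset.subset_univ Sᶜ)]
  · exact Finset.sum_congr rfl fun i hi => h S i (Finset.mem_compl.mp hi)
  · intro i _ hi
    rw [← basis_singleton]
    refine basis_mul_eq_zero k ?_
    simpa using hi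

end Grassmann

/-- If an operator squares to zero and permutes up to nonzero factors the edges of a cube, then the
factors along the two paths around each square are opposite. -/
theorem cube_coefficients_anticomm {k ι M : Type*} [Field k] [Fintype ι] [DecidableEq ι]
    [AddCommGroup M] [Module k M] {v : Finset ι → M} {φ : Finset ι → M →ₗ[k] k}
    (hφ : ∀ S T, φ T (v S) = if S = T then 1 else 0) {D : M →ₗ[k] M} {u : Finset ι → ι → k}
    (hD : ∀ S, D (v S) = ∑ i ∈ Sᶜ, u S i • v (insert i S)) (hDD : ∀ S, D (D (v S)) = 0)
    {S : Finset ι} {i j : ι} (hi : i ∉ S) (hj : j ∉ S) (hij : i ≠ j) :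
    u S i * u (insert i S) j + u S j * u (insert j S) i = 0 := by
  -- Compare the coefficients at `S ∪ {i, j}`: only the paths adding `i` then `j`, or `j` then `i`,
  -- reach it.
  have h := congrArg (φ (insert i (insert j S))) (hDD S)
  have hφ' : ∀ x, φ (insert i (insert j S)) (D (v (insert x S))) =
      ∑ y ∈ (insert x S)ᶜ, if insert y (insert x S) = insert i (insert j S)
        then u (insert x S) y else 0 := by
    intro x
    simp only [hD, map_sum, map_smul, hφ, smul_eq_mul, mul_ite, mul_one, mul_zero]
  rw [hD S] at h
  simp only [map_sum, map_smul, map_zero, hφ', smul_eq_mul] at h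
  have hsub : ∀ {x y}, x ∉ S → insert y (insert x S) = insert i (insert j S) → x = i ∨ x = j := by
    intro x y hx e
    have : x ∈ insert i (insert j S) := e ▸ by simp
    simpa [hx] using this
  have one : ∀ {x y : ι}, x ∉ S → y ∉ S → x ≠ y →
      insert y (insert x S) = insert i (insert j S) →
      (∑ z ∈ (insert x S)ᶜ, if insert z (insert x S) = insert i (insert j S)
        then u (insert x S) z else 0) = u (insert x S) y := by
    intro x y hx hy hxy e
    have hy' : y ∉ insert x S := by simp [hy, Ne.symm hxy]
    rw [Finset.sum_eq_single y, if_pos e]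
    · intro z hz hzy
      rw [if_neg]
      intro e'
      have : z ∈ insert y (insert x S) := (e'.trans e.symm) ▸ Finset.mem_insert_self _ _
      exact (Finset.mem_insert.mp this).elim hzy (Finset.mem_compl.mp hz)
    · intro h
      exact (h (Finset.mem_compl.mpr hy')).elim
  rw [Finset.sum_eq_add i j hij, one hi hj hij (Finset.insert_comm _ _ _),
    one hj hi hij.symm rfl] at h
  · exact h
  · rintro x hx ⟨h1, h2⟩
    rw [Finset.sum_eq_zero, mul_zero]
    intro y _
    rw [if_neg]
    intro e
    exact (hsub (Finset.mem_compl.mp hx) e).elim h1 h2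
  · exact fun h => (h (Finset.mem_compl.mpr hi)).elim
  · exact fun h => (h (Finset.mem_compl.mpr hj)).elim

/-! ### The isomorphism of complexes. -/

namespace MonomialOperad
open Grassmann

/-- Isolates what is needed of contractions: a parametrization `T` of the decorated trees over `w`
by subsets, matching the gradings, the vanishing conditions and the supports of the differentials.
-/
theorem exists_isIso_of_cube (k : Type*) [Field k] (P : MonomialOperad) {L : Type}
    (w : P.Monomial L) {ι : Type} [Fintype ι] [LinearOrder ι] (R : Set (Finset ι))
    {T : Finset ι → DTree P.gen P.arity L} (hinj : Function.Injective T)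
    (hflat : ∀ t, DTree.flatten t = w ↔ ∃ S, T S = t)
    (hsize : ∀ S, (T S).size + S.card = w.size)
    (hvan : ∀ S, DTree.Vanishes P.rel (T S) ↔ ∃ A ∈ R, A ⊆ S)
    (hD : ∀ S, ∃ u : ι → k, (∀ i, u i ≠ 0) ∧
      DTree.barDiff k (T S) = ∑ i ∈ Sᶜ, u i • Finsupp.single (T (insert i S)) 1) :
    ∃ φ : P.barComplex k w ⟶ Grassmann.complex k ι R, IsIso φ := by
  classical
  choose u hu hD using hD
  obtain ⟨g, hg, hmul⟩ := exists_basis_mul_sum_gen k ι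
  set D := Finsupp.linearCombination k (DTree.barDiff (V := P.gen) (ar := P.arity) (L := L) k)
    with hDdef
  have hDT : ∀ S, D (Finsupp.single (T S) 1) =
      ∑ i ∈ Sᶜ, u S i • Finsupp.single (T (insert i S)) 1 := fun S => by
    rw [hDdef, Finsupp.linearCombination_single, one_smul, hD]
  have hu' := fun S i j (hi : i ∉ S) (hj : j ∉ S) (hij : i ≠ j) =>
    cube_coefficients_anticomm (v := fun S => Finsupp.single (T S) (1 : k))
      (φ := fun S => Finsupp.lapply (T S)) (D := D) (u := u)
      (fun S S' => by simp [Finsupp.single_apply, hinj.eq_iff]) hDT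
      (fun S => by
        rw [hDdef, Finsupp.linearCombination_single, one_smul, DTree.barDiff_sq]) hi hj hij
  have hg' := fun S i j (hi : i ∉ S) (hj : j ∉ S) (hij : i ≠ j) =>
    cube_coefficients_anticomm (v := basis k ι)
      (φ := fun S => (basis k ι).coord S)
      (D := LinearMap.mulRight k (∑ i, Grassmann.gen k ι i)) (u := g)
      (fun S S' => by simp [Finsupp.single_apply]) (fun S => hmul S)
      (fun S => by
        have h : (∑ i, Grassmann.gen k ι i) * (∑ i, Grassmann.gen k ι i) = 0 := by
          simp only [Grassmann.gen, ← map_sum]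
          exact ExteriorAlgebra.ι_sq_zero _
        rw [LinearMap.mulRight_apply, LinearMap.mulRight_apply, mul_assoc, h, mul_zero]) hi hj hij
  -- Numerator and denominator both change sign when the two directions are exchanged, so their
  -- quotient commutes.
  obtain ⟨ε, hε, hεu⟩ := exists_rescaling (fun S i => g S i / u S i)
    (fun S i => div_ne_zero (hg S i) (hu S i)) (fun S i j hi hj hij => by
      rw [div_mul_div_comm, div_mul_div_comm, eq_neg_of_add_eq_zero_left (hu' S i j hi hj hij),
        eq_neg_of_add_eq_zero_left (hg' S i j hi hj hij), neg_div_neg_eq])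
  -- The rescaled comparison is defined on the whole free bar construction, as zero on trees with
  -- another total composition. It commutes with the differentials, and has inverse `Ψ`, on the span
  -- of the trees over `w`.
  set Φ : (DTree P.gen P.arity L →₀ k) →ₗ[k] ExteriorAlgebra k (ι →₀ k) :=
    Finsupp.linearCombination k (Function.extend T (fun S => ε S • basis k ι S) 0) with hΦdef
  set Ψ : ExteriorAlgebra k (ι →₀ k) →ₗ[k] (DTree P.gen P.arity L →₀ k) :=
    (basis k ι).constr k (fun S => (ε S)⁻¹ • Finsupp.single (T S) 1) with hΨdef
  have hΦT : ∀ S, Φ (Finsupp.single (T S) 1) = ε S • basis k ι S := fun S => by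
    rw [hΦdef, Finsupp.linearCombination_single, one_smul, hinj.extend_apply]
  have hΨb : ∀ S, Ψ (basis k ι S) = (ε S)⁻¹ • Finsupp.single (T S) 1 := fun S => by
    rw [hΨdef, Module.Basis.constr_basis]
  have hΦΨ : ∀ x, Φ (Ψ x) = x := fun x => by
    refine LinearMap.congr_fun (f := Φ ∘ₗ Ψ) (g := LinearMap.id) ((basis k ι).ext fun S => ?_) x
    rw [LinearMap.comp_apply, hΨb, map_smul, hΦT, smul_smul, inv_mul_cancel₀ (hε S), one_smul]
    rfl
  set A : ℕ → Set (DTree P.gen P.arity L) :=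
    fun j => {T | DTree.flatten T = w ∧ T.size + j = w.size} with hAdef
  have hA : ∀ j, A j = T '' {S | S.card = j} := by
    intro j
    ext t
    constructor
    · rintro ⟨h1, h2⟩
      obtain ⟨S, rfl⟩ := (hflat t).mp h1
      have := hsize S
      exact ⟨S, show S.card = j by omega, rfl⟩
    · rintro ⟨S, rfl, rfl⟩
      exact ⟨(hflat _).mpr ⟨S, rfl⟩, hsize S⟩
  have hsupp : ∀ j, Finsupp.supported k k (A j) =
      Submodule.span k ((fun S => Finsupp.single (T S) (1 : k)) '' {S | S.card = j}) := by
    intro j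
    rw [hA, Finsupp.supported_eq_span_single, Set.image_image]
  have hΦA : ∀ j, ∀ y ∈ Finsupp.supported k k (A j), Φ y ∈ ⋀[k]^j (ι →₀ k) := by
    intro j y hy
    rw [hsupp] at hy
    rw [exteriorPower_eq_span]
    refine (Submodule.span_le (p := (Submodule.span k _).comap Φ)).mpr ?_ hy
    rintro _ ⟨S, hS, rfl⟩
    rw [SetLike.mem_coe, Submodule.mem_comap]
    rw [hΦT]
    exact Submodule.smul_mem _ _ (Submodule.subset_span ⟨S, hS, rfl⟩)
  have hΨA : ∀ j, ∀ x ∈ ⋀[k]^j (ι →₀ k), Ψ x ∈ Finsupp.supported k k (A j) := by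
    intro j x hx
    rw [exteriorPower_eq_span] at hx
    rw [hsupp]
    refine (Submodule.span_le (p := (Submodule.span k _).comap Ψ)).mpr ?_ hx
    rintro _ ⟨S, hS, rfl⟩
    rw [SetLike.mem_coe, Submodule.mem_comap]
    rw [hΨb]
    exact Submodule.smul_mem _ _ (Submodule.subset_span ⟨S, hS, rfl⟩)
  have hΨΦ : ∀ j, ∀ y ∈ Finsupp.supported k k (A j), Ψ (Φ y) = y := by
    intro j y hy
    rw [hsupp] at hy
    refine LinearMap.eqOn_span (f := Ψ ∘ₗ Φ) (g := LinearMap.id) ?_ hy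
    rintro _ ⟨S, hS, rfl⟩
    dsimp only [LinearMap.comp_apply, LinearMap.id_apply]
    rw [hΦT, map_smul, hΨb, smul_smul, mul_inv_cancel₀ (hε S), one_smul]
  have hΦD : ∀ j, ∀ y ∈ Finsupp.supported k k (A j), Φ (D y) = Φ y * ∑ i, Grassmann.gen k ι i := by
    intro j y hy
    rw [hsupp] at hy
    refine LinearMap.eqOn_span (f := Φ ∘ₗ D)
      (g := LinearMap.mulRight k (∑ i, Grassmann.gen k ι i) ∘ₗ Φ) ?_ hy
    rintro _ ⟨S, hS, rfl⟩
    dsimp only [LinearMap.comp_apply, LinearMap.mulRight_apply]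
    rw [hDT, hΦT, smul_mul_assoc, hmul, map_sum, Finset.smul_sum]
    refine Finset.sum_congr rfl fun i hi => ?_
    rw [map_smul, hΦT, smul_smul, smul_smul, hεu S i (Finset.mem_compl.mp hi)]
    congr 1
    field_simp [hu S i]
  have hΨI : ∀ x ∈ monomialIdeal k ι R, Ψ x ∈ barKernel k P L := by
    intro x hx
    rw [mem_monomialIdeal_iff] at hx
    refine (Submodule.span_le (p := (barKernel k P L).comap Ψ)).mpr ?_ hx
    rintro _ ⟨S, hS, rfl⟩
    rw [SetLike.mem_coe, Submodule.mem_comap]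
    rw [hΨb]
    exact Submodule.smul_mem _ _ (Finsupp.single_mem_supported k _ ((hvan S).mpr hS))
  have hΦK : ∀ y ∈ barKernel k P L, Φ y ∈ monomialIdeal k ι R := by
    intro y hy
    rw [barKernel, Finsupp.supported_eq_span_single] at hy
    rw [mem_monomialIdeal_iff]
    refine (Submodule.span_le (p := (Submodule.span k _).comap Φ)).mpr ?_ hy
    rintro _ ⟨t, ht, rfl⟩
    dsimp only
    rw [SetLike.mem_coe, Submodule.mem_comap]
    -- The kernel also contains vanishing trees whose total composition is not `w`; these are sent
    -- to 0.
    by_cases h : ∃ S, T S = t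
    · obtain ⟨S, rfl⟩ := h
      rw [hΦT]
      exact Submodule.smul_mem _ _ (Submodule.subset_span ⟨S, (hvan S).mp ht, rfl⟩)
    · rw [hΦdef, Finsupp.linearCombination_single, Function.extend_apply' _ _ _ h]
      simp
  set π := (Ideal.Quotient.mkₐ k (monomialIdeal k ι R)).toLinearMap with hπdef
  have hπ0 : ∀ x, π x = 0 ↔ x ∈ monomialIdeal k ι R := fun x => Ideal.Quotient.eq_zero_iff_mem
  set F : Bar k P L →ₗ[k] QuotientAlgebra k ι R := (barKernel k P L).liftQ (π ∘ₗ Φ)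
    (fun y hy => (hπ0 _).mpr (hΦK y hy)) with hFdef
  have hF : ∀ y, F ((barKernel k P L).mkQ y) = π (Φ y) := fun y => rfl
  have hFmem : ∀ j, ∀ x ∈ barPiece k P w j, F x ∈ piece k ι R j := by
    rintro j _ ⟨y, hy, rfl⟩
    exact ⟨Φ y, hΦA j y hy, rfl⟩
  -- `Φ` and `Ψ` each respect the grading and carry the spans divided out into one another, so they
  -- are inverse on each graded piece of the quotients.
  have hbij : ∀ j, Function.Bijective (F.restrict (hFmem j)) := by
    intro j
    constructor
    · rw [← LinearMap.ker_eq_bot, LinearMap.ker_eq_bot']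
      rintro ⟨_, y, hy, rfl⟩ h
      have h1 : π (Φ y) = 0 := congrArg Subtype.val h
      have h2 := hΨI _ ((hπ0 _).mp h1)
      rw [hΨΦ j y hy] at h2
      exact Subtype.ext ((Submodule.Quotient.mk_eq_zero _).mpr h2)
    · rintro ⟨_, x, hx, rfl⟩
      refine ⟨⟨_, Ψ x, hΨA j x hx, rfl⟩, Subtype.ext ?_⟩
      exact congrArg π (hΦΨ x)
  have hcomm : ∀ j, ∀ x ∈ barPiece k P w j, d k ι R (F x) = F (barD k P L x) := by
    rintro j _ ⟨y, hy, rfl⟩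
    have h1 : barD k P L ((barKernel k P L).mkQ y) = (barKernel k P L).mkQ (D y) := rfl
    rw [h1, hF, hF, hΦD j y hy]
    exact (map_mul (Ideal.Quotient.mk (monomialIdeal k ι R)) _ _).symm
  let φ : P.barComplex k w ⟶ Grassmann.complex k ι R :=
    CochainComplex.ofHom (fun j => ModuleCat.ofHom (F.restrict (hFmem j))) (fun j => by
      dsimp only [barComplex, Grassmann.complex]
      rw [CochainComplex.of_d, CochainComplex.of_d]
      refine ModuleCat.hom_ext (LinearMap.ext fun x => Subtype.ext ?_)
      exact hcomm j x.1 x.2)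
  have hφ : ∀ j, IsIso (φ.f j) := fun j =>
    (LinearEquiv.ofBijective (F.restrict (hFmem j)) (hbij j)).toModuleIso.isIso_hom
  exact ⟨φ, HomologicalComplex.Hom.isIso_of_components φ⟩

/-- The index type is only equivalent to the set of edges, so that the same statement serves
`w.edges` itself and `Fin n`. -/
theorem exists_isIso_of_equiv (k : Type*) [Field k] (P : MonomialOperad) {L : Type}
    (w : P.Monomial L) {ι : Type} [Fintype ι] (e : ι ≃ w.edges) (R : Set (Finset ι))
    (hR : ∀ S : Finset ι, DTree.OccursWithin P.rel {a | ∃ i ∈ S, (e i).1 = a} w ↔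
      ∃ A ∈ R, A ⊆ S) :
    ∃ φ : P.barComplex k w ⟶ Grassmann.complex k ι R, IsIso φ := by
  classical
  -- Any order will do: it enters through the basis and not through the complex.
  let _ : LinearOrder ι := LinearOrder.lift' (Fintype.equivFin ι) (Fintype.equivFin ι).injective
  obtain ⟨C, hC⟩ : ∃ C : Finset ι → Set (List ℕ), ∀ S, C S = {a | ∃ i ∈ S, (e i).1 = a} :=
    ⟨_, fun _ => rfl⟩
  simp only [← hC] at hR
  have hmem : ∀ (S : Finset ι) i, (e i).1 ∈ C S ↔ i ∈ S := by
    intro S i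
    rw [hC]
    constructor
    · rintro ⟨j, hj, h⟩
      exact e.injective (Subtype.ext h) ▸ hj
    · exact fun h => ⟨i, h, rfl⟩
  refine exists_isIso_of_cube k P w R
    (T := fun S => DTree.contract (C S) w) ?_ ?_ ?_ ?_ ?_
  · intro S S' h
    ext i
    rw [← hmem S, ← hmem S']
    exact DTree.contract_inj h _ (e i).2
  · intro t
    constructor
    · rintro rfl
      obtain ⟨S, hS⟩ := DTree.exists_contract_flatten t
      -- The set `S` may contain addresses that are not edges; dropping them does not change the
      -- contraction.
      refine ⟨Finset.univ.filter fun i => (e i).1 ∈ S, ?_⟩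
      refine Eq.trans ?_ hS
      refine congrArg DTree.ofLabelled (DTree.contractRoot_congr fun a ha => ?_)
      obtain ⟨i, hi⟩ := e.surjective ⟨a, ha⟩
      obtain rfl : (e i).1 = a := congrArg Subtype.val hi
      rw [hmem]
      simp
    · rintro ⟨S, rfl⟩
      exact DTree.flatten_contract _ _
  · intro S
    rw [← DTree.size_contract_add_card (C S) w]
    congr 1
    refine Finset.card_bij (fun i _ => (e i).1) ?_ ?_ ?_
    · exact fun i hi => Finset.mem_filter.mpr ⟨(e i).2, (hmem S i).mpr hi⟩
    · exact fun i _ j _ h => e.injective (Subtype.ext h)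
    · intro a ha
      obtain ⟨ha, ha'⟩ := Finset.mem_filter.mp ha
      obtain ⟨i, hi⟩ := e.surjective ⟨a, ha⟩
      obtain rfl : (e i).1 = a := congrArg Subtype.val hi
      exact ⟨i, (hmem S i).mp ha', rfl⟩
  · intro S
    rw [DTree.vanishes_contract P.rel_nontrivial, hR]
  · intro S
    obtain ⟨u, hu, h⟩ := DTree.barDiff_contract k (C S) w
    refine ⟨fun i => u (e i).1, fun i => hu _, ?_⟩
    rw [h]
    symm
    refine Finset.sum_bij (fun i _ => (e i).1) ?_ ?_ ?_ ?_
    · intro i hi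
      exact Finset.mem_filter.mpr ⟨(e i).2, fun h => Finset.mem_compl.mp hi ((hmem S i).mp h)⟩
    · exact fun i _ j _ h => e.injective (Subtype.ext h)
    · intro a ha
      obtain ⟨ha, ha'⟩ := Finset.mem_filter.mp ha
      obtain ⟨i, hi⟩ := e.surjective ⟨a, ha⟩
      obtain rfl : (e i).1 = a := congrArg Subtype.val hi
      exact ⟨i, Finset.mem_compl.mpr fun h => ha' ((hmem S i).mpr h), rfl⟩
    · intro i _
      congr 3
      ext a
      simp [hC, eq_comm]

theorem occursWithin_iff_relationSets (P : MonomialOperad) {L : Type} (w : P.Monomial L)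
    (S : Finset w.edges) :
    DTree.OccursWithin P.rel {a | ∃ i ∈ S, i.1 = a} w ↔ ∃ A ∈ P.relationSets w, A ⊆ S := by
  constructor
  · rintro ⟨a, _, h, r, hr, ⟨f, rfl⟩, hS⟩
    refine ⟨Finset.univ.filter fun i => i.1 ∈ r.edges.image fun b => a ++ b,
      ⟨r, hr, a, f, h, ?_⟩, ?_⟩
    · ext x
      constructor
      · intro hx
        obtain ⟨i, hi, rfl⟩ := Finset.mem_image.mp hx
        exact (Finset.mem_filter.mp hi).2
      · intro hx
        obtain ⟨b, hb, rfl⟩ := Finset.mem_image.mp hx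
        exact Finset.mem_image.mpr ⟨⟨_, PTree.append_mem_edges_of_subtreeAt h hb⟩,
          Finset.mem_filter.mpr ⟨Finset.mem_univ _, hx⟩, rfl⟩
    · intro i hi
      obtain ⟨b, hb, hbi⟩ := Finset.mem_image.mp (Finset.mem_filter.mp hi).2
      obtain ⟨j, hj, hji⟩ := hS b hb
      rwa [← Subtype.ext (hji.trans hbi)]
  · rintro ⟨A, ⟨r, hr, a, f, h, hA⟩, hAS⟩
    refine ⟨a, _, h, r, hr, ⟨f, rfl⟩, fun b hb => ?_⟩
    have : a ++ b ∈ A.image Subtype.val := hA ▸ Finset.mem_image_of_mem _ hb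
    obtain ⟨i, hi, h⟩ := Finset.mem_image.mp this
    exact ⟨i, hAS hi, h⟩

theorem exists_isIso (k : Type*) [Field k] (P : MonomialOperad) {L : Type} (w : P.Monomial L) :
    ∃ φ : P.barComplex k w ⟶ Grassmann.complex k w.edges (P.relationSets w), IsIso φ :=
  exists_isIso_of_equiv k P w (Equiv.refl _) _ (P.occursWithin_iff_relationSets w)

/-! ### Realizing an arbitrary family of subsets. -/

/-- The arities of the generators of `corollaOperad n`: the root vertex has `n` inputs and the other
generator has one. -/
def corollaArity (n : ℕ) : Bool → ℕ
  | true => n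
  | false => 1

open PTree in
/-- The tree monomial with a root vertex of arity `n`, and with a unary vertex on each of the inputs of
the root vertex which belong to `S`. -/
def corolla {n : ℕ} (S : Finset (Fin (corollaArity n true))) : PTree Bool (corollaArity n) Unit :=
  node true fun i => if i ∈ S then node false fun _ => leaf () else leaf ()

/-- The nonsymmetric monomial operad with relations `corolla S`, `S ∈ R`. -/
def corollaOperad {n : ℕ} (R : Set (Finset (Fin (corollaArity n true)))) : MonomialOperad where
  gen := Bool
  finite_gen := inferInstance
  arity := corollaArity n
  rel := corolla '' R
  finite_rel := R.toFinite.image _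
  rel_nontrivial := by
    rintro _ ⟨S, -, rfl⟩
    exact fun h => h

open PTree in
theorem mem_edges_corolla {n : ℕ} {S : Finset (Fin (corollaArity n true))} {a : List ℕ} :
    a ∈ (corolla S).edges ↔ ∃ i ∈ S, [i.val] = a := by
  rw [corolla, mem_edges_node]
  constructor
  · rintro ⟨i, b, hb, rfl⟩
    by_cases hi : i ∈ S
    · rw [if_pos hi, mem_vertices_node] at hb
      rcases hb with rfl | ⟨_, _, hb, -⟩
      · exact ⟨i, hi, rfl⟩
      · simp [vertices] at hb
    · rw [if_neg hi] at hb
      simp [vertices] at hb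
  · rintro ⟨i, hi, rfl⟩
    refine ⟨i, [], ?_, rfl⟩
    rw [if_pos hi, mem_vertices_node]
    exact Or.inl rfl

-- The unary vertices on inputs outside `A` are grafted onto leaves of `corolla A`.
open PTree in
theorem exists_corolla_univ_eq_graft {n : ℕ} (A : Finset (Fin (corollaArity n true))) :
    ∃ f, (corolla Finset.univ : PTree Bool (corollaArity n) Unit) = graft (corolla A) f := by
  rw [corolla, corolla, exists_graft_node]
  intro i
  rw [if_pos (Finset.mem_univ i)]
  by_cases hi : i ∈ A
  · rw [if_pos hi]
    exact exists_graft_node.mpr fun _ => exists_graft_leaf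
  · rw [if_neg hi]
    exact exists_graft_leaf

-- The generator `true` labels the root of every relation but no vertex of `w` above its root.
-- Labels decide this, so the case `n = 1`, where the two arities agree, is no exception.
open PTree in
theorem subtreeAt_corolla_eq_graft {n : ℕ} {A : Finset (Fin (corollaArity n true))} {a : List ℕ}
    {f : Fin (corolla A).numLeaves → PTree Bool (corollaArity n) Unit}
    (h : (corolla Finset.univ : PTree Bool (corollaArity n) Unit).subtreeAt a =
      some (graft (corolla A) f)) : a = [] := by
  rcases (exists_subtreeAt_node (p := fun b s => b = a ∧ s = graft (corolla A) f)).mp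
    ⟨a, _, h, rfl, rfl⟩ with h | ⟨i, b, s, h1, -, rfl⟩
  · exact h.1.symm
  · rw [if_pos (Finset.mem_univ i)] at h1
    rcases (exists_subtreeAt_node (p := fun _ s => s = graft (corolla A) f)).mp
      ⟨b, _, h1, rfl⟩ with h | ⟨_, b, s, h1, rfl⟩
    · simp [corolla, graft] at h
    · have := (exists_subtreeAt_leaf (p := fun _ s => s = graft (corolla A) f)).mp ⟨b, _, h1, rfl⟩
      simp [corolla, graft] at this

open PTree in
theorem occursWithin_corolla {n : ℕ} (R : Set (Finset (Fin (corollaArity n true))))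
    (S : Finset (Fin (corollaArity n true))) :
    DTree.OccursWithin (corollaOperad R).rel {a | ∃ i ∈ S, [i.val] = a}
      (corolla Finset.univ : PTree Bool (corollaArity n) Unit) ↔ ∃ A ∈ R, A ⊆ S := by
  constructor
  · rintro ⟨a, s, h, _, ⟨A, hA, rfl⟩, ⟨f, rfl⟩, hS⟩
    obtain rfl := subtreeAt_corolla_eq_graft h
    refine ⟨A, hA, fun i hi => ?_⟩
    obtain ⟨j, hj, h⟩ := hS [i.val] (mem_edges_corolla.mpr ⟨i, hi, rfl⟩)
    rwa [← Fin.ext (List.cons.inj h).1]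
  · rintro ⟨A, hA, hAS⟩
    refine ⟨[], _, rfl, corolla A, ⟨A, hA, rfl⟩, exists_corolla_univ_eq_graft A, fun b hb => ?_⟩
    obtain ⟨i, hi, rfl⟩ := mem_edges_corolla.mp hb
    exact ⟨i, hAS hi, rfl⟩

theorem exists_isIso_corolla (k : Type*) [Field k] {n : ℕ} (R : Set (Finset (Fin n))) :
    ∃ φ : (corollaOperad R).barComplex k (corolla Finset.univ : PTree Bool (corollaArity n) Unit) ⟶
      Grassmann.complex k (Fin n) R, IsIso φ := by
  refine exists_isIso_of_equiv k (corollaOperad R) (corolla Finset.univ)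
    (Equiv.ofBijective (fun i : Fin n => ⟨[i.val], mem_edges_corolla.mpr ⟨i, Finset.mem_univ i, rfl⟩⟩)
      ⟨fun i j h => Fin.ext (List.cons.inj (congrArg Subtype.val h)).1, ?_⟩) R
    (occursWithin_corolla R)
  rintro ⟨a, ha⟩
  obtain ⟨i, -, rfl⟩ := mem_edges_corolla.mp ha
  exact ⟨i, rfl⟩

end MonomialOperad

theorem mainTheorem7 (k : Type*) [Field k] :
    (∀ (P : MonomialOperad) (L : Type) (w : P.Monomial L),
      ∃ φ : P.barComplex k w ⟶ Grassmann.complex k w.edges (P.relationSets w), QuasiIso φ) ∧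
    (∀ (n : ℕ) (R : Set (Finset (Fin n))),
      ∃ (P : MonomialOperad) (w : P.Monomial Unit),
        ∀ j : ℕ, Nonempty ((P.barComplex k w).homology j ≅
          (Grassmann.complex k (Fin n) R).homology j)) := by
  refine ⟨fun P L w => ?_, fun n R => ?_⟩
  · obtain ⟨φ, hφ⟩ := P.exists_isIso k w
    exact ⟨φ, inferInstance⟩
  · obtain ⟨φ, hφ⟩ := MonomialOperad.exists_isIso_corolla k R
    exact ⟨MonomialOperad.corollaOperad R, MonomialOperad.corolla Finset.univ,
      fun j => ⟨(HomologicalComplex.homologyFunctor _ _ j).mapIso (asIso φ)⟩⟩
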